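/- Let $n\ge 1$, $0<\alpha<n/2$, $q_1,q_2\in(0,1)$, and put $\gamma_1=\frac{1+q_1}{1-q_1q_2}$, $\gamma_2=\frac{1+q_2}{1-q_1q_2}$. For a nonnegative Borel measure $\nu$ on $\mathbb{R}^n$ let $\mathbf{I}_{\beta}\nu(x)=\int_{\mathbb{R}^n}|x-y|^{-(n-\beta)}\,d\nu(y)\in[0,\infty]$ $(0<\beta<n)$ be its Riesz potential, and for $E\subset\mathbb{R}^n$ let $$\mathrm{cap}_{\alpha,2}(E)=\inf\{\|f\|_{L^2(\mathbb{R}^n)}^2:\ f\ge 0 \text{ measurable},\ \mathbf{I}_\alpha(f\,dx)\ge 1\text{ on }E\}$$ be the Riesz capacity. Let $\sigma,\mu_1,\mu_2$ be nonnegative locally finite Borel measures on $\mathbb{R}^n$, not necessarily radially symmetric, such that $\mathbf{I}_{2\alpha}\sigma\not\equiv\infty$. Suppose that there is a constant $C_\sigma$ with $$\sigma(E)\le C_\sigma\,\mathrm{cap}_{\alpha,2}(E)\quad\text{for all compact sets }E\subset\mathbb{R}^n,$$ and that, for $i=1,2$, there is a constant $C>0$ with $\mathbf{I}_{2\alpha}\mu_i(x)\le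 C\,\mathbf{I}_{2\alpha}\sigma(x)$ for all $x\in\mathbb{R}^n$. Then there are measurable functions $u,v:\mathbb{R}^n\to[0,\infty]$, finite almost everywhere, that solve the system $$u=\mathbf{I}_{2\alpha}(v^{q_1}d\sigma+d\mu_1),\qquad v=\mathbf{I}_{2\alpha}(u^{q_2}d\sigma+d\mu_2)\quad\text{on }\mathbb{R}^n,$$ with $\liminf_{|x|\to\infty}u(x)=\liminf_{|x|\to\infty}v(x)=0$, and there is a constant $c>0$ such that, everywhere on $\mathbb{R}^n$, $$c^{-1}(\mathbf{I}_{2\alpha}\sigma)^{\gamma_1}\le u\le c\big(\mathbf{I}_{2\alpha}\sigma+(\mathbf{I}_{2\alpha}\sigma)^{\gamma_1}\big),\qquad c^{-1}(\mathbf{I}_{2\alpha}\sigma)^{\gamma_2}\le v\le c\big(\mathbf{I}_{2\alpha}\sigma+(\mathbf{I}_{2\alpha}\sigma)^{\gamma_2}\big).$$ -/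

import Mathlib

open MeasureTheory Filter
open scoped ENNReal NNReal

noncomputable section

/-- The Riesz potential `I_β ν (x) = ∫ dν(y) / |x - y| ^ (n - β)` of a measure `ν` on `ℝⁿ`, with
values in `[0, ∞]`. For `β < n` the kernel takes the value `∞` on the diagonal. -/
def rieszPotential {n : ℕ} (β : ℝ) (ν : Measure (EuclideanSpace ℝ (Fin n)))
    (x : EuclideanSpace ℝ (Fin n)) : ℝ≥0∞ :=
  ∫⁻ y, (edist x y ^ ((n : ℝ) - β))⁻¹ ∂ν

/-- The Riesz capacity `cap_{α,2}(E) = inf { ‖f‖₂² : f ≥ 0 measurable, I_α f ≥ 1 on E }`, where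
`I_α f` is the Riesz potential of the measure `f dx`. Functions with infinite norm do not affect
the infimum. -/
def rieszCapacity {n : ℕ} (α : ℝ) (E : Set (EuclideanSpace ℝ (Fin n))) : ℝ≥0∞ :=
  ⨅ (f : EuclideanSpace ℝ (Fin n) → ℝ≥0∞) (_ : Measurable f)
    (_ : ∀ x ∈ E, 1 ≤ rieszPotential α (volume.withDensity f) x), ∫⁻ y, f y ^ (2 : ℝ)

/-- `(u, v)` solves the inhomogeneous system `(-Δ)^α u = σ v^{q₁} + μ₁`, `(-Δ)^α v = σ u^{q₂} + μ₂`
on `ℝⁿ`, understood in the integral sense, with both functions finite almost everywhere and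
with lower limit zero at infinity. -/
structure IsSolution {n : ℕ} (α q₁ q₂ : ℝ) (σ μ₁ μ₂ : Measure (EuclideanSpace ℝ (Fin n)))
    (u v : EuclideanSpace ℝ (Fin n) → ℝ≥0∞) : Prop where
  measurable_u : Measurable u
  measurable_v : Measurable v
  finite_u : ∀ᵐ x, u x < ∞
  finite_v : ∀ᵐ x, v x < ∞
  eq_u : ∀ x, u x = rieszPotential (2 * α) (σ.withDensity (fun y => v y ^ q₁) + μ₁) x
  eq_v : ∀ x, v x = rieszPotential (2 * α) (σ.withDensity (fun y => u y ^ q₂) + μ₂) x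
  liminf_u : liminf u (cocompact (EuclideanSpace ℝ (Fin n))) = 0
  liminf_v : liminf v (cocompact (EuclideanSpace ℝ (Fin n))) = 0

end

/-!
Write `a = n - 2α`, `k(x, y) = |x - y| ^ (-a)` for the kernel and `W = I_{2α} σ`. The solution is
the limit of a monotone iteration (`exists_solution_between`) which starts from the subsolution
`(b⁻¹ W ^ γ₁, b⁻¹ W ^ γ₂)` and stays below the supersolution
`(b (W + W ^ γ₁), b (W + W ^ γ₂))`, with `b` large. As `γ₂ q₁ + 1 = γ₁` and `γ₁ q₂ + 1 = γ₂`, and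
as `q₁, q₂ < 1` lets large constants be absorbed, both properties reduce to two-sided pointwise
bounds for `I_{2α}(W ^ p dσ)`.

* Lower bound `W ^ (p + 1) ≤ C I_{2α}(W ^ p dσ)` (`kernelPotential_rpow_add_one_le`). If
  `|x - z| ≥ |x - y|`, then `|y - z| ≤ 2 |x - z|`. Hence `W(y)` dominates the mass which
  `dm = k(x, ·) dσ` gives to the points `z` that are at least as far from `x` as `y`. This mass is
  at least a quarter of the total mass `W(x)` for `y` in a set of `m`-measure at least `W(x) / 2`.

* Upper bound `I_{2α}(W ^ p dσ) ≤ C (W + W ^ (p + 1))`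
  (`exists_kernelPotential_withDensity_rpow_le`). Testing the capacity with multiples of `f` shows
  that `I_α` maps `L²(dx)` into weak `L²(σ)`. By duality `‖I_α σ_S‖₂² ≤ C σ(S)`, and the inequality
  `k ≤ C k_α * k_α` turns this into the energy estimate `∫_S I_{2α} σ_S dσ ≤ C σ(S)` for all sets
  `S` of finite measure (`exists_lintegral_rieszPotential_restrict_le`). As it holds for all `S`,
  the weak maximum principle gives a good-λ inequality, and from it the estimate
  `∫_B (I_{2α} σ_B) ^ p dσ ≤ C σ(B)` for every `p`. On a ball `B(x, r)` the function `W` is at most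
  `I_{2α} σ_{B(x, 2r)} + C W(x)`; inserting the moment estimate and integrating over `r` by means of
  the layer cake formula for `k(x, ·)` gives the bound.

Finally, a potential which is finite at one point is locally integrable and has averages tending to
zero over large balls, since the average of `k(·, y)` over `B(x₀, R)` is at most
`C min (R ^ (-a)) (k(x₀, y))`. This gives finiteness almost everywhere and the lower limit zero at
infinity.
-/

noncomputable section

/-! ### Layer cake formula and the Riesz kernel -/

theorem volume_Ioi_inter_ofReal_lt (c : ℝ≥0∞) :
    volume (Set.Ioi (0 : ℝ) ∩ {t | ENNReal.ofReal t < c}) = c := by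
  rcases eq_or_ne c ∞ with rfl | hc
  · have : Set.Ioi (0 : ℝ) ∩ {t | ENNReal.ofReal t < ∞} = Set.Ioi 0 := by
      ext t; simp
    rw [this, Real.volume_Ioi]
  · have : Set.Ioi (0 : ℝ) ∩ {t | ENNReal.ofReal t < c} = Set.Ioo 0 c.toReal := by
      ext t
      simp only [Set.mem_inter_iff, Set.mem_Ioi, Set.mem_ofPred_eq, Set.mem_Ioo,
        and_congr_right_iff]
      intro ht
      exact ENNReal.ofReal_lt_iff_lt_toReal ht.le hc
    rw [this, Real.volume_Ioo, sub_zero, ENNReal.ofReal_toReal hc]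

/-- The layer cake formula for functions with values in `[0, ∞]`. -/
theorem lintegral_eq_lintegral_measure_superlevel {X : Type*} [MeasurableSpace X] (μ : Measure X)
    [SFinite μ] {g : X → ℝ≥0∞} (hg : Measurable g) :
    ∫⁻ x, g x ∂μ = ∫⁻ t in Set.Ioi (0 : ℝ), μ {x | ENNReal.ofReal t < g x} := by
  have hm : MeasurableSet {p : X × ℝ | ENNReal.ofReal p.2 < g p.1} :=
    measurableSet_lt (by fun_prop) (by fun_prop)
  calc ∫⁻ x, g x ∂μ
      = ∫⁻ x, (∫⁻ t in Set.Ioi (0 : ℝ),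
          {p : X × ℝ | ENNReal.ofReal p.2 < g p.1}.indicator 1 (x, t)) ∂μ := by
        refine lintegral_congr fun x => ?_
        have hx : MeasurableSet {t : ℝ | ENNReal.ofReal t < g x} :=
          measurableSet_lt (by fun_prop) (by fun_prop)
        have : ∀ t : ℝ, {p : X × ℝ | ENNReal.ofReal p.2 < g p.1}.indicator
            (1 : X × ℝ → ℝ≥0∞) (x, t) = {t : ℝ | ENNReal.ofReal t < g x}.indicator 1 t :=
          fun t => rfl
        simp_rw [this]
        rw [lintegral_indicator_one hx, Measure.restrict_apply hx, Set.inter_comm,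
          volume_Ioi_inter_ofReal_lt]
    _ = ∫⁻ t in Set.Ioi (0 : ℝ), ∫⁻ x,
          {p : X × ℝ | ENNReal.ofReal p.2 < g p.1}.indicator 1 (x, t) ∂μ := by
        refine lintegral_lintegral_swap ?_
        exact (measurable_one.indicator hm).aemeasurable
    _ = _ := by
        refine lintegral_congr fun t => ?_
        have hx : MeasurableSet {x | ENNReal.ofReal t < g x} :=
          measurableSet_lt (by fun_prop) (by fun_prop)
        rw [← lintegral_indicator_one hx]
        rfl

theorem ENNReal.add_rpow_le_two_rpow_mul (a b : ℝ≥0∞) {p : ℝ} (hp : 0 ≤ p) :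
    (a + b) ^ p ≤ 2 ^ p * (a ^ p + b ^ p) := by
  calc (a + b) ^ p ≤ (2 * max a b) ^ p := by
        refine ENNReal.rpow_le_rpow ?_ hp
        rw [two_mul]
        exact add_le_add (le_max_left _ _) (le_max_right _ _)
    _ = 2 ^ p * (max a b) ^ p := ENNReal.mul_rpow_of_nonneg _ _ hp
    _ ≤ _ := by
        gcongr
        rcases le_total a b with h | h
        · rw [max_eq_right h]; exact le_add_self
        · rw [max_eq_left h]; exact le_self_add

/-- The Riesz kernel `|x - y| ^ (-a)`, infinite on the diagonal when `0 < a`. -/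
def rieszKernel {X : Type*} [EDist X] (a : ℝ) (x y : X) : ℝ≥0∞ := (edist x y ^ a)⁻¹

/-- The potential of `ν` with respect to the kernel `|x - y| ^ (-a)`. It is parametrized by the
decay exponent `a` and makes sense on every metric space; the Riesz potential of order `β` on
`ℝⁿ` is the case `a = n - β`. -/
def kernelPotential {X : Type*} [EDist X] [MeasurableSpace X] (a : ℝ) (ν : Measure X) (x : X) :
    ℝ≥0∞ := ∫⁻ y, rieszKernel a x y ∂ν

theorem rieszPotential_eq_kernelPotential {n : ℕ} (β : ℝ)
    (ν : Measure (EuclideanSpace ℝ (Fin n))) (x : EuclideanSpace ℝ (Fin n)) :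
    rieszPotential β ν x = kernelPotential ((n : ℝ) - β) ν x := rfl

theorem kernelPotential_mono {X : Type*} [EDist X] [MeasurableSpace X] {a : ℝ} {ν ν' : Measure X}
    (h : ν ≤ ν') (x : X) : kernelPotential a ν x ≤ kernelPotential a ν' x :=
  lintegral_mono' h le_rfl

theorem kernelPotential_add_measure {X : Type*} [EDist X] [MeasurableSpace X] {a : ℝ}
    (μ ν : Measure X) (x : X) :
    kernelPotential a (μ + ν) x = kernelPotential a μ x + kernelPotential a ν x :=
  lintegral_add_measure _ _ _

section Kernel

variable {X : Type*} [MetricSpace X] {a : ℝ}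

theorem rieszKernel_comm (x y : X) : rieszKernel a x y = rieszKernel a y x := by
  rw [rieszKernel, rieszKernel, edist_comm]

theorem rieszKernel_self (ha : 0 < a) (x : X) : rieszKernel a x x = ∞ := by
  simp [rieszKernel, ha]

theorem continuous_rieszKernel_left (y : X) : Continuous fun x : X => rieszKernel a x y := by
  unfold rieszKernel
  exact continuous_inv.comp
    (ENNReal.continuous_rpow_const.comp (continuous_id.edist continuous_const))

theorem continuous_rieszKernel : Continuous fun p : X × X => rieszKernel a p.1 p.2 := by
  unfold rieszKernel
  exact continuous_inv.comp (ENNReal.continuous_rpow_const.comp continuous_edist)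

/-- The kernel decreases in the distance, at a polynomial rate. -/
theorem rieszKernel_le_of_edist_le (ha : 0 < a) {c : ℝ≥0∞} (hc : c ≠ 0) (hc' : c ≠ ∞)
    {x y x' y' : X} (h : edist x y ≤ c * edist x' y') :
    rieszKernel a x' y' ≤ c ^ a * rieszKernel a x y := by
  have h1 : edist x y ^ a ≤ c ^ a * edist x' y' ^ a := by
    rw [← ENNReal.mul_rpow_of_nonneg _ _ ha.le]
    exact ENNReal.rpow_le_rpow h ha.le
  have h0 : c ^ a ≠ 0 := (ENNReal.rpow_pos (pos_iff_ne_zero.2 hc) hc').ne'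
  have h2 : c ^ a ≠ ∞ := ENNReal.rpow_ne_top_of_nonneg ha.le hc'
  have h3 := ENNReal.inv_le_inv.2 h1
  rw [ENNReal.mul_inv (Or.inl h0) (Or.inl h2)] at h3
  calc rieszKernel a x' y' = c ^ a * ((c ^ a)⁻¹ * rieszKernel a x' y') := by
        rw [← mul_assoc, ENNReal.mul_inv_cancel h0 h2, one_mul]
    _ ≤ _ := by gcongr; exact h3

variable [MeasurableSpace X] [BorelSpace X] [SecondCountableTopology X]

theorem measurable_rieszKernel : Measurable fun p : X × X => rieszKernel a p.1 p.2 :=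
  continuous_rieszKernel.measurable

theorem measurable_rieszKernel_right (x : X) : Measurable (rieszKernel a x) :=
  Measurable.of_uncurry_left (f := rieszKernel a) measurable_rieszKernel

theorem measurable_kernelPotential (ν : Measure X) [SFinite ν] :
    Measurable (kernelPotential a ν) :=
  measurable_rieszKernel.lintegral_prod_right'

theorem kernelPotential_withDensity (ν : Measure X) {g : X → ℝ≥0∞} (hg : Measurable g) (x : X) :
    kernelPotential a (ν.withDensity g) x = ∫⁻ y, g y * rieszKernel a x y ∂ν :=
  lintegral_withDensity_eq_lintegral_mul _ hg (measurable_rieszKernel_right x)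

/-- Symmetry of the potential operator. -/
theorem lintegral_kernelPotential_comm (μ ν : Measure X) [SFinite μ] [SFinite ν] :
    ∫⁻ x, kernelPotential a μ x ∂ν = ∫⁻ x, kernelPotential a ν x ∂μ := by
  unfold kernelPotential
  rw [lintegral_lintegral_swap measurable_rieszKernel.aemeasurable]
  simp_rw [rieszKernel_comm]

/-- The potential is lower semicontinuous; this is Fatou's lemma. -/
theorem isClosed_kernelPotential_le (ν : Measure X) (t : ℝ≥0∞) :
    IsClosed {x | kernelPotential a ν x ≤ t} := by
  refine isClosed_of_closure_subset fun x hx => ?_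
  obtain ⟨u, hu, hux⟩ := mem_closure_iff_seq_limit.1 hx
  calc kernelPotential a ν x = ∫⁻ y, liminf (fun j => rieszKernel a (u j) y) atTop ∂ν := by
        refine lintegral_congr fun y => (Tendsto.liminf_eq ?_).symm
        exact ((continuous_rieszKernel_left y).tendsto x).comp hux
    _ ≤ liminf (fun j => ∫⁻ y, rieszKernel a (u j) y ∂ν) atTop :=
        lintegral_liminf_le fun j => measurable_rieszKernel_right (u j)
    _ ≤ t := liminf_le_of_frequently_le' (Frequently.of_forall hu)

/-- Weak maximum principle: a bound for the potential on a set which carries the measure extends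
to the whole space, up to a factor. -/
theorem kernelPotential_restrict_le (ha : 0 < a) (ν : Measure X) {S : Set X}
    (hS : MeasurableSet S) {t : ℝ≥0∞}
    (h : ∀ x ∈ S, kernelPotential a (ν.restrict S) x ≤ t) (x : X) :
    kernelPotential a (ν.restrict S) x ≤ 3 ^ a * t := by
  have h1 : (1 : ℝ≥0∞) ≤ 3 ^ a := ENNReal.one_le_rpow (by norm_num) ha
  by_cases hx : x ∈ closure S
  · have : kernelPotential a (ν.restrict S) x ≤ t :=
      closure_minimal (t := {x | kernelPotential a (ν.restrict S) x ≤ t}) h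
        (isClosed_kernelPotential_le _ _) hx
    calc _ ≤ 1 * t := by rwa [one_mul]
      _ ≤ _ := by gcongr
  rcases S.eq_empty_or_nonempty with rfl | hne
  · simp [kernelPotential]
  have hd : Metric.infEDist x S ≠ 0 := fun h0 => hx (Metric.mem_closure_iff_infEDist_zero.2 h0)
  have hd' : Metric.infEDist x S ≠ ∞ := Metric.infEDist_ne_top hne
  obtain ⟨x', hx', hlt⟩ : ∃ x' ∈ S, edist x x' < 2 * Metric.infEDist x S := by
    refine Metric.infEDist_lt_iff.1 ?_
    rw [two_mul]
    exact ENNReal.lt_add_right hd' hd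
  calc kernelPotential a (ν.restrict S) x
      ≤ ∫⁻ y in S, 3 ^ a * rieszKernel a x' y ∂ν := by
        refine setLIntegral_mono' hS fun y hy => ?_
        refine rieszKernel_le_of_edist_le ha (by norm_num) (by norm_num) ?_
        calc edist x' y ≤ edist x' x + edist x y := edist_triangle _ _ _
          _ ≤ 2 * edist x y + edist x y := by
              gcongr
              rw [edist_comm]
              refine hlt.le.trans ?_
              gcongr
              exact Metric.infEDist_le_edist_of_mem hy
          _ = 3 * edist x y := by ring
    _ = 3 ^ a * kernelPotential a (ν.restrict S) x' :=
        lintegral_const_mul _ (measurable_rieszKernel_right _)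
    _ ≤ _ := by gcongr; exact h x' hx'

end Kernel

/-! ### From the capacity condition to an energy estimate -/

section Capacity

variable {n : ℕ} {α : ℝ} {C : ℝ≥0} {σ : Measure (EuclideanSpace ℝ (Fin n))}

/-- Weak-type trace inequality: the set where `I_α f` exceeds `t` has capacity at most
`‖f‖₂² / t²`, since `f / t` is admissible for its compact subsets. -/
theorem measure_superlevel_rieszPotential_le
    (hcap : ∀ K, IsCompact K → σ K ≤ C * rieszCapacity α K)
    {S : Set (EuclideanSpace ℝ (Fin n))} (hSm : σ S ≠ ∞)
    {f : EuclideanSpace ℝ (Fin n) → ℝ≥0∞} (hf : Measurable f) {t : ℝ≥0∞} (ht : t ≠ 0)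
    (ht' : t ≠ ∞) [IsLocallyFiniteMeasure σ] :
    σ.restrict S {x | t < rieszPotential α (volume.withDensity f) x} ≤
      C * (t ^ (-2 : ℝ) * ∫⁻ y, f y ^ (2 : ℝ)) := by
  have hm : MeasurableSet {x | t < rieszPotential α (volume.withDensity f) x} :=
    measurableSet_lt measurable_const (measurable_kernelPotential _)
  have hfin : IsFiniteMeasure (σ.restrict S) := ⟨by simpa using hSm.lt_top⟩
  refine le_of_forall_lt fun r hr => ?_
  obtain ⟨K, hKS, hK, hrK⟩ := hm.exists_lt_isCompact_of_ne_top (measure_ne_top _ _) hr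
  refine hrK.trans_le (((Measure.restrict_apply_le _ _).trans (hcap K hK)).trans ?_)
  gcongr
  have hadm : ∀ x ∈ K,
      1 ≤ rieszPotential α (volume.withDensity fun y => t⁻¹ * f y) x := by
    intro x hx
    have h2 : t < rieszPotential α (volume.withDensity f) x := hKS hx
    rw [rieszPotential_eq_kernelPotential, kernelPotential_withDensity _ hf] at h2
    rw [rieszPotential_eq_kernelPotential,
      kernelPotential_withDensity _ (by fun_prop : Measurable fun y => t⁻¹ * f y)]
    simp_rw [mul_assoc]
    rw [lintegral_const_mul' _ _ (ENNReal.inv_ne_top.2 ht),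
      ← ENNReal.inv_mul_cancel ht ht']
    gcongr
  refine (iInf₂_le_of_le _ (by fun_prop) (iInf_le _ hadm)).trans (le_of_eq ?_)
  simp_rw [ENNReal.mul_rpow_of_nonneg _ _ (zero_le_two (α := ℝ))]
  rw [lintegral_const_mul _ (by fun_prop), ENNReal.inv_rpow, ENNReal.rpow_neg]

theorem lintegral_Ioi_ofReal_rpow {l s : ℝ} (hl : 0 < l) (hs : s < -1) :
    ∫⁻ t in Set.Ioi l, ENNReal.ofReal t ^ s = ENNReal.ofReal (-l ^ (s + 1) / (s + 1)) := by
  calc ∫⁻ t in Set.Ioi l, ENNReal.ofReal t ^ s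
      = ∫⁻ t in Set.Ioi l, ENNReal.ofReal (t ^ s) :=
        setLIntegral_congr_fun measurableSet_Ioi fun t (ht : l < t) =>
          ENNReal.ofReal_rpow_of_pos (hl.trans ht)
    _ = ENNReal.ofReal (∫ t in Set.Ioi l, t ^ s) := by
        refine (ofReal_integral_eq_lintegral_ofReal
          (integrableOn_Ioi_rpow_of_lt hs hl) ?_).symm
        filter_upwards [ae_restrict_mem measurableSet_Ioi] with t ht
        exact Real.rpow_nonneg (hl.trans ht).le _
    _ = _ := by rw [integral_Ioi_rpow_of_lt hs hl]

theorem lintegral_Ioi_ofReal_rpow_neg_two {l : ℝ} (hl : 0 < l) :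
    ∫⁻ t in Set.Ioi l, ENNReal.ofReal t ^ (-2 : ℝ) = ENNReal.ofReal l⁻¹ := by
  rw [lintegral_Ioi_ofReal_rpow hl (by norm_num)]
  norm_num [Real.rpow_neg_one]

/-- Dual form of the weak-type trace inequality, for test functions of finite norm. -/
theorem lintegral_sq_le_of_le_rieszPotential [IsLocallyFiniteMeasure σ]
    (hC : 0 < C) (hcap : ∀ K, IsCompact K → σ K ≤ C * rieszCapacity α K)
    {S : Set (EuclideanSpace ℝ (Fin n))} (hSm : σ S ≠ ∞)
    {f : EuclideanSpace ℝ (Fin n) → ℝ≥0∞} (hf : Measurable f)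
    (hf2 : ∫⁻ y, f y ^ (2 : ℝ) ≠ ∞) (hle : ∀ y, f y ≤ rieszPotential α (σ.restrict S) y) :
    ∫⁻ y, f y ^ (2 : ℝ) ≤ 4 * C * σ S := by
  set J := ∫⁻ y, f y ^ (2 : ℝ) with hJ
  have hφ : Measurable (kernelPotential ((n : ℝ) - α) (σ.restrict S)) :=
    measurable_kernelPotential _
  have hIf : Measurable (kernelPotential ((n : ℝ) - α) (volume.withDensity f)) :=
    measurable_kernelPotential _
  have hl : (0 : ℝ) < 2 * C := by positivity
  -- The weak-type bound is used above the level `2 * C`, which makes the coefficient of the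
  -- finite quantity `J` on the right-hand side equal to `1 / 2`.
  have key : J ≤ 2 * C * σ S + J / 2 := by
    calc J ≤ ∫⁻ y, f y * kernelPotential ((n : ℝ) - α) (σ.restrict S) y := by
          refine lintegral_mono fun y => ?_
          rw [ENNReal.rpow_two, sq]
          exact mul_le_mul_right (hle y) _
      _ = ∫⁻ y, kernelPotential ((n : ℝ) - α) (σ.restrict S) y ∂(volume.withDensity f) :=
          (lintegral_withDensity_eq_lintegral_mul _ hf hφ).symm
      _ = ∫⁻ x in S, kernelPotential ((n : ℝ) - α) (volume.withDensity f) x ∂σ :=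
          lintegral_kernelPotential_comm _ _
      _ = ∫⁻ t in Set.Ioi (0 : ℝ), σ.restrict S
            {x | ENNReal.ofReal t < rieszPotential α (volume.withDensity f) x} :=
          lintegral_eq_lintegral_measure_superlevel _ hIf
      _ ≤ (∫⁻ t in Set.Ioc (0 : ℝ) (2 * C), σ.restrict S
            {x | ENNReal.ofReal t < rieszPotential α (volume.withDensity f) x}) +
          ∫⁻ t in Set.Ioi (2 * C : ℝ), σ.restrict S
            {x | ENNReal.ofReal t < rieszPotential α (volume.withDensity f) x} := by
          rw [← Set.Ioc_union_Ioi_eq_Ioi hl.le]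
          exact lintegral_union_le _ _ _
      _ ≤ (∫⁻ t in Set.Ioc (0 : ℝ) (2 * C), σ S) +
          ∫⁻ t in Set.Ioi (2 * C : ℝ), C * (ENNReal.ofReal t ^ (-2 : ℝ) * J) := by
          refine add_le_add (lintegral_mono fun t => ?_) ?_
          · exact (measure_mono (Set.subset_univ _)).trans (by simp)
          · refine setLIntegral_mono' measurableSet_Ioi fun t (ht : 2 * C < t) => ?_
            exact measure_superlevel_rieszPotential_le hcap hSm hf
              (ENNReal.ofReal_pos.2 (hl.trans ht)).ne' ENNReal.ofReal_ne_top
      _ = 2 * C * σ S + J / 2 := by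
          congr 1
          · rw [setLIntegral_const, Real.volume_Ioc, sub_zero, mul_comm,
              ENNReal.ofReal_mul (by norm_num)]
            simp
          · rw [lintegral_const_mul _ (by fun_prop), lintegral_mul_const _ (by fun_prop),
              lintegral_Ioi_ofReal_rpow_neg_two hl, ENNReal.ofReal_inv_of_pos hl,
              ENNReal.ofReal_mul (by norm_num), ENNReal.ofReal_coe_nnreal,
              ENNReal.mul_inv (Or.inl (by norm_num)) (Or.inl (by norm_num)), ← mul_assoc,
              mul_comm (C : ℝ≥0∞), mul_assoc (ENNReal.ofReal 2)⁻¹,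
              ENNReal.inv_mul_cancel (by exact_mod_cast hC.ne') ENNReal.coe_ne_top, mul_one,
              ENNReal.div_eq_inv_mul]
            norm_num
  have h2 : J / 2 ≠ ∞ := ENNReal.div_ne_top hf2 (by norm_num)
  have h3 : J / 2 ≤ 2 * C * σ S := by
    refine (ENNReal.add_le_add_iff_right h2).1 ?_
    rwa [ENNReal.add_halves]
  calc J = 2 * (J / 2) := (ENNReal.mul_div_cancel (by norm_num) (by norm_num)).symm
    _ ≤ 2 * (2 * C * σ S) := by gcongr
    _ = 4 * C * σ S := by ring

/-- Dual trace inequality on characteristic functions: `‖I_α σ_S‖₂² ≤ 4 C σ(S)`. -/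
theorem lintegral_rieszPotential_restrict_sq_le [IsLocallyFiniteMeasure σ]
    (hC : 0 < C) (hcap : ∀ K, IsCompact K → σ K ≤ C * rieszCapacity α K)
    {S : Set (EuclideanSpace ℝ (Fin n))} (hSm : σ S ≠ ∞) :
    ∫⁻ y, rieszPotential α (σ.restrict S) y ^ (2 : ℝ) ≤ 4 * C * σ S := by
  refine le_of_forall_lt fun L hL => ?_
  simp_rw [lintegral_eq_nnreal, lt_iSup_iff] at hL
  obtain ⟨g₀, hg₀, hLg₀⟩ := hL
  rw [← SimpleFunc.lintegral_eq_lintegral, SimpleFunc.coe_map] at hLg₀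
  obtain ⟨g, hg, hgfin, hLg⟩ := SimpleFunc.exists_lt_lintegral_simpleFunc_of_lt_lintegral hLg₀
  have hsq : ∀ y, ((g y : ℝ≥0∞) ^ (1 / 2 : ℝ)) ^ (2 : ℝ) = g y := by
    intro y
    rw [← ENNReal.rpow_mul]
    norm_num
  have h := lintegral_sq_le_of_le_rieszPotential hC hcap hSm
    (f := fun y => (g y : ℝ≥0∞) ^ (1 / 2 : ℝ)) (by fun_prop)
    (by simp_rw [hsq]; exact hgfin.ne) (fun y => by
      calc ((g y : ℝ≥0∞)) ^ (1 / 2 : ℝ)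
          ≤ (rieszPotential α (σ.restrict S) y ^ (2 : ℝ)) ^ (1 / 2 : ℝ) :=
            ENNReal.rpow_le_rpow ((ENNReal.coe_le_coe.2 (hg y)).trans (hg₀ y)) (by norm_num)
        _ = _ := by rw [← ENNReal.rpow_mul]; norm_num)
  simp_rw [hsq] at h
  exact hLg.trans_le h

/-- One half of the semigroup property of Riesz kernels, up to a constant: it suffices to integrate
over the ball of radius `R` slightly larger than `|x - y|` centred at `x`. -/
theorem exists_rieszKernel_le_lintegral_mul (hα : 0 < α) (hαn : α < (n : ℝ) / 2) :
    ∃ K : ℝ≥0, ∀ x y : EuclideanSpace ℝ (Fin n), rieszKernel ((n : ℝ) - 2 * α) x y ≤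
      K * ∫⁻ z, rieszKernel ((n : ℝ) - α) z x * rieszKernel ((n : ℝ) - α) z y := by
  set b : ℝ := (n : ℝ) - α with hb
  have hb0 : 0 < b := by linarith
  set V : ℝ≥0∞ := volume (Metric.ball (0 : EuclideanSpace ℝ (Fin n)) 1) with hV
  have hV0 : V ≠ 0 := (Metric.measure_ball_pos _ _ one_pos).ne'
  have hV' : V ≠ ∞ := measure_ball_lt_top.ne
  have h2 : (2 : ℝ≥0∞) ^ b ≠ ∞ := ENNReal.rpow_ne_top_of_nonneg hb0.le (by norm_num)
  have h20 : (2 : ℝ≥0∞) ^ b ≠ 0 := (ENNReal.rpow_pos (by norm_num) (by norm_num)).ne'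
  have hK : 2 ^ b * V⁻¹ ≠ ∞ := ENNReal.mul_ne_top h2 (ENNReal.inv_ne_top.2 hV0)
  refine ⟨(2 ^ b * V⁻¹).toNNReal, fun x y => ?_⟩
  rw [ENNReal.coe_toNNReal hK]
  have hstep : ∀ R : ℝ≥0∞, edist x y < R → R ≠ ∞ → (R ^ ((n : ℝ) - 2 * α))⁻¹ ≤
      2 ^ b * V⁻¹ * ∫⁻ z, rieszKernel b z x * rieszKernel b z y := by
    intro R hR hR'
    have hR0 : R ≠ 0 := (bot_le.trans_lt hR).ne'
    have hvol : volume (Metric.eball x R) = R ^ (n : ℝ) * V := by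
      have hr : 0 < R.toReal := ENNReal.toReal_pos hR0 hR'
      rw [← ENNReal.ofReal_toReal hR', Metric.eball_ofReal,
        Measure.addHaar_ball_of_pos _ _ hr, finrank_euclideanSpace_fin,
        ENNReal.ofReal_pow hr.le, ENNReal.rpow_natCast]
    calc (R ^ ((n : ℝ) - 2 * α))⁻¹
        = (2 ^ b * (2 ^ b)⁻¹) * (V⁻¹ * V) * (R ^ ((n : ℝ) - 2 * α))⁻¹ := by
          rw [ENNReal.mul_inv_cancel h20 h2, ENNReal.inv_mul_cancel hV0 hV', one_mul, one_mul]
      _ = 2 ^ b * V⁻¹ * ((R ^ b)⁻¹ * ((2 * R) ^ b)⁻¹ * (R ^ (n : ℝ) * V)) := by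
          have : (R ^ ((n : ℝ) - 2 * α))⁻¹ = (R ^ b)⁻¹ * (R ^ b)⁻¹ * R ^ (n : ℝ) := by
            rw [← ENNReal.rpow_neg, ← ENNReal.rpow_neg, ← ENNReal.rpow_add _ _ hR0 hR',
              ← ENNReal.rpow_add _ _ hR0 hR']
            congr 1
            rw [hb]; ring
          rw [this, ENNReal.mul_rpow_of_nonneg _ _ hb0.le,
            ENNReal.mul_inv (Or.inl h20) (Or.inl h2)]
          ring
      _ = 2 ^ b * V⁻¹ * ∫⁻ z in Metric.eball x R, (R ^ b)⁻¹ * ((2 * R) ^ b)⁻¹ := by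
          rw [setLIntegral_const, hvol]
      _ ≤ 2 ^ b * V⁻¹ *
          ∫⁻ z in Metric.eball x R, rieszKernel b z x * rieszKernel b z y := by
          refine mul_le_mul' le_rfl (setLIntegral_mono' measurableSet_eball fun z hz => ?_)
          have hz' : edist z x ≤ R := (Metric.mem_eball.1 hz).le
          unfold rieszKernel
          gcongr
          calc edist z y ≤ edist z x + edist x y := edist_triangle _ _ _
            _ ≤ R + R := by gcongr
            _ = 2 * R := (two_mul R).symm
      _ ≤ _ := by gcongr; exact Measure.restrict_le_self
  have hne : (nhdsWithin (edist x y) (Set.Ioi (edist x y))).NeBot :=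
    nhdsGT_neBot_of_exists_gt ⟨∞, edist_lt_top x y⟩
  have hlim : Tendsto (fun R : ℝ≥0∞ => (R ^ ((n : ℝ) - 2 * α))⁻¹)
      (nhdsWithin (edist x y) (Set.Ioi (edist x y))) (nhds (rieszKernel ((n : ℝ) - 2 * α) x y)) :=
    ((continuous_inv.comp ENNReal.continuous_rpow_const).tendsto _).mono_left nhdsWithin_le_nhds
  refine le_of_tendsto hlim ?_
  filter_upwards [self_mem_nhdsWithin, mem_nhdsWithin_of_mem_nhds
    (Iio_mem_nhds (edist_lt_top x y))] with R h1 h2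
  exact hstep R h1 (ne_of_lt h2)

theorem lintegral_lintegral_mul_kernel {X Y : Type*} [MeasurableSpace X] [MeasurableSpace Y]
    (μ : Measure X) (ν : Measure Y) [SFinite μ] [SFinite ν] {k : Y → X → ℝ≥0∞}
    (hk : Measurable fun p : Y × X => k p.1 p.2) :
    ∫⁻ x, ∫⁻ y, (∫⁻ z, k z x * k z y ∂ν) ∂μ ∂μ = ∫⁻ z, (∫⁻ x, k z x ∂μ) ^ (2 : ℝ) ∂ν := by
  have hφ : Measurable fun z => ∫⁻ x, k z x ∂μ := hk.lintegral_prod_right'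
  have hkz : ∀ z, Measurable (k z) := fun z => hk.of_uncurry_left
  have hkx : ∀ x, Measurable fun z => k z x := fun x => hk.of_uncurry_right
  calc ∫⁻ x, ∫⁻ y, (∫⁻ z, k z x * k z y ∂ν) ∂μ ∂μ
      = ∫⁻ x, (∫⁻ z, k z x * ∫⁻ y, k z y ∂μ ∂ν) ∂μ := by
        refine lintegral_congr fun x => ?_
        rw [lintegral_lintegral_swap]
        · exact lintegral_congr fun z => lintegral_const_mul _ (hkz z)
        · exact (((hkx x).comp measurable_snd).mul (hk.comp measurable_swap)).aemeasurable
    _ = ∫⁻ z, (∫⁻ x, k z x * ∫⁻ y, k z y ∂μ ∂μ) ∂ν := by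
        refine lintegral_lintegral_swap ?_
        exact ((hk.comp measurable_swap).mul (hφ.comp measurable_snd)).aemeasurable
    _ = _ := by
        refine lintegral_congr fun z => ?_
        rw [lintegral_mul_const _ (hkz z), ENNReal.rpow_two, sq]

/-- Energy estimate: under the capacity condition, the energy of the restriction of `σ` to any set
of finite measure is controlled by the measure of that set. -/
theorem exists_lintegral_rieszPotential_restrict_le [IsLocallyFiniteMeasure σ] (hα : 0 < α)
    (hαn : α < (n : ℝ) / 2) (hcap : ∃ C : ℝ≥0, ∀ K, IsCompact K → σ K ≤ C * rieszCapacity α K) :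
    ∃ K : ℝ≥0, ∀ S, σ S ≠ ∞ →
      ∫⁻ x in S, kernelPotential ((n : ℝ) - 2 * α) (σ.restrict S) x ∂σ ≤ K * σ S := by
  obtain ⟨C₀, hC₀⟩ := hcap
  have hcap : ∀ K, IsCompact K → σ K ≤ ((C₀ + 1 : ℝ≥0) : ℝ≥0∞) * rieszCapacity α K := by
    intro K hK
    refine (hC₀ K hK).trans ?_
    gcongr
    exact le_self_add
  obtain ⟨K, hK⟩ := exists_rieszKernel_le_lintegral_mul hα hαn
  refine ⟨K * (4 * (C₀ + 1)), fun S hS => ?_⟩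
  set b : ℝ := (n : ℝ) - α with hb
  have hle : ∀ x y : EuclideanSpace ℝ (Fin n), rieszKernel ((n : ℝ) - 2 * α) x y ≤
      K * ∫⁻ z, rieszKernel b z x * rieszKernel b z y := hK
  calc ∫⁻ x in S, kernelPotential ((n : ℝ) - 2 * α) (σ.restrict S) x ∂σ
      ≤ ∫⁻ x in S, ∫⁻ y in S, K * (∫⁻ z, rieszKernel b z x * rieszKernel b z y) ∂σ ∂σ :=
        lintegral_mono fun x => lintegral_mono fun y => hle x y
    _ = K * ∫⁻ x in S, ∫⁻ y in S, (∫⁻ z, rieszKernel b z x * rieszKernel b z y) ∂σ ∂σ := by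
        rw [← lintegral_const_mul' _ _ ENNReal.coe_ne_top]
        refine lintegral_congr fun x => lintegral_const_mul' _ _ ENNReal.coe_ne_top
    _ = K * ∫⁻ z, rieszPotential α (σ.restrict S) z ^ (2 : ℝ) := by
        rw [lintegral_lintegral_mul_kernel (σ.restrict S) volume measurable_rieszKernel]
        rfl
    _ ≤ K * (4 * ((C₀ + 1 : ℝ≥0) : ℝ≥0∞) * σ S) := by
        gcongr
        exact lintegral_rieszPotential_restrict_sq_le (by positivity) hcap hS
    _ = _ := by push_cast; ring

end Capacity

/-! ### Upper bound for the potential of a power of the potential -/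

section UpperBound

variable {X : Type*} [MetricSpace X] [MeasurableSpace X] [BorelSpace X]
  [SecondCountableTopology X] {a : ℝ} {σ : Measure X} {K : ℝ≥0}

/-- Good-λ inequality. The part of `σ_B` carried by `{w ≤ τ}`, where `w` is the potential of `σ_B`,
contributes at most `3 ^ a * τ` to `w` by the weak maximum principle, so that on
`{2 * 3 ^ a * τ < w}` the potential is dominated by that of the part carried by `{τ < w}`. -/
theorem setLIntegral_superlevel_le (ha : 0 < a) [SFinite σ]
    (hK : ∀ S, σ S ≠ ∞ → ∫⁻ x in S, kernelPotential a (σ.restrict S) x ∂σ ≤ K * σ S)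
    {B : Set X} (hB : MeasurableSet B) (hB' : σ B ≠ ∞) (τ : ℝ≥0∞) :
    ∫⁻ x in {x | 2 * 3 ^ a * τ < kernelPotential a (σ.restrict B) x},
        kernelPotential a (σ.restrict B) x ∂(σ.restrict B) ≤
      2 * K * σ.restrict B {x | τ < kernelPotential a (σ.restrict B) x} := by
  set w := kernelPotential a (σ.restrict B) with hw
  have hwm : Measurable w := measurable_kernelPotential _
  have hL : MeasurableSet {x | τ < w x} := measurableSet_lt measurable_const hwm
  have hL' : MeasurableSet {x | w x ≤ τ} := measurableSet_le hwm measurable_const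
  have h3 : (1 : ℝ≥0∞) ≤ 3 ^ a := ENNReal.one_le_rpow (by norm_num) ha
  set E := {x | τ < w x} ∩ B with hE
  set S := {x | w x ≤ τ} ∩ B with hS
  have hEB : σ E ≠ ∞ := ((measure_mono Set.inter_subset_right).trans_lt hB'.lt_top).ne
  have hsplit : ∀ x, w x = kernelPotential a (σ.restrict E) x +
      kernelPotential a (σ.restrict S) x := by
    intro x
    rw [← kernelPotential_add_measure, hw, hE, hS, ← Measure.restrict_restrict hL,
      ← Measure.restrict_restrict hL']
    congr 1
    have : {x | w x ≤ τ} = {x | τ < w x}ᶜ := by ext; simp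
    rw [this, Measure.restrict_add_restrict_compl hL]
  have hsmall : ∀ x, kernelPotential a (σ.restrict S) x ≤ 3 ^ a * τ := by
    refine kernelPotential_restrict_le ha σ (hL'.inter hB) fun x hx => ?_
    exact (kernelPotential_mono (Measure.restrict_mono Set.inter_subset_right le_rfl) x).trans
      hx.1
  have hbig : ∀ x, 2 * 3 ^ a * τ < w x → w x ≤ 2 * kernelPotential a (σ.restrict E) x := by
    intro x hx
    have h1 : 3 ^ a * τ ≤ kernelPotential a (σ.restrict E) x := by
      by_contra! hlt
      refine hx.not_ge ?_
      rw [hsplit x, mul_assoc, two_mul]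
      exact add_le_add hlt.le (hsmall x)
    rw [hsplit x, two_mul]
    gcongr
    exact (hsmall x).trans h1
  calc ∫⁻ x in {x | 2 * 3 ^ a * τ < w x}, w x ∂(σ.restrict B)
      ≤ ∫⁻ x in {x | 2 * 3 ^ a * τ < w x}, 2 * kernelPotential a (σ.restrict E) x
          ∂(σ.restrict B) :=
        setLIntegral_mono' (measurableSet_lt measurable_const hwm) hbig
    _ ≤ ∫⁻ x in {x | τ < w x}, 2 * kernelPotential a (σ.restrict E) x ∂(σ.restrict B) := by
        refine lintegral_mono_set fun x (hx : _ < w x) => lt_of_le_of_lt ?_ hx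
        calc τ = 1 * 1 * τ := by simp
          _ ≤ 2 * 3 ^ a * τ := by gcongr; norm_num
    _ = 2 * ∫⁻ x in E, kernelPotential a (σ.restrict E) x ∂σ := by
        rw [Measure.restrict_restrict hL, lintegral_const_mul' _ _ (by norm_num)]
    _ ≤ 2 * (K * σ E) := by gcongr; exact hK E hEB
    _ = _ := by rw [Measure.restrict_apply hL, mul_assoc]

/-- The good-λ inequality, integrated over all levels. -/
theorem setLIntegral_kernelPotential_rpow_add_one_le (ha : 0 < a) [SFinite σ]
    (hK : ∀ S, σ S ≠ ∞ → ∫⁻ x in S, kernelPotential a (σ.restrict S) x ∂σ ≤ K * σ S)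
    {B : Set X} (hB : MeasurableSet B) (hB' : σ B ≠ ∞) {p : ℝ} (hp : 0 < p) :
    ∫⁻ x in B, kernelPotential a (σ.restrict B) x ^ (p + 1) ∂σ ≤
      (2 * 3 ^ a) ^ p * (2 * K) * ∫⁻ x in B, kernelPotential a (σ.restrict B) x ^ p ∂σ := by
  set w := kernelPotential a (σ.restrict B) with hw
  have hwm : Measurable w := measurable_kernelPotential _
  set c : ℝ≥0∞ := 2 * 3 ^ a with hc
  have hc' : c ≠ ∞ :=
    ENNReal.mul_ne_top (by norm_num) (ENNReal.rpow_ne_top_of_nonneg ha.le (by norm_num))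
  have hc0 : c ≠ 0 :=
    mul_ne_zero (by norm_num) (ENNReal.rpow_pos (by norm_num) (by norm_num)).ne'
  have hlevel : ∀ (d : ℝ≥0∞) (t : ℝ), d ≠ 0 → d ≠ ∞ →
      {x | ENNReal.ofReal t < (d⁻¹ * w x) ^ p} =
        {x | d * (ENNReal.ofReal t) ^ p⁻¹ < w x} := by
    intro d t hd hd'
    ext x
    rw [Set.mem_ofPred_eq, Set.mem_ofPred_eq]
    conv_lhs => rw [← ENNReal.rpow_inv_rpow hp.ne' (ENNReal.ofReal t),
      ENNReal.rpow_lt_rpow_iff hp]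
    rw [← ENNReal.div_eq_inv_mul, ENNReal.lt_div_iff_mul_lt (Or.inl hd) (Or.inl hd'), mul_comm]
  calc ∫⁻ x in B, w x ^ (p + 1) ∂σ
      = ∫⁻ x in B, c ^ p * (w x * (c⁻¹ * w x) ^ p) ∂σ := by
        refine lintegral_congr fun x => ?_
        rw [ENNReal.rpow_add_of_nonneg _ _ hp.le zero_le_one, ENNReal.rpow_one,
          mul_left_comm, ← ENNReal.mul_rpow_of_nonneg _ _ hp.le, ← mul_assoc,
          ENNReal.mul_inv_cancel hc0 hc', one_mul, mul_comm]
    _ = c ^ p * ∫⁻ x, (c⁻¹ * w x) ^ p ∂((σ.restrict B).withDensity w) := by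
        rw [lintegral_const_mul _ (by fun_prop),
          lintegral_withDensity_eq_lintegral_mul _ hwm (by fun_prop)]
        rfl
    _ = c ^ p * ∫⁻ t in Set.Ioi (0 : ℝ), (σ.restrict B).withDensity w
          {x | ENNReal.ofReal t < (c⁻¹ * w x) ^ p} := by
        rw [lintegral_eq_lintegral_measure_superlevel _ (by fun_prop)]
    _ ≤ c ^ p * ∫⁻ t in Set.Ioi (0 : ℝ), 2 * K * σ.restrict B {x | ENNReal.ofReal t < w x ^ p} := by
        gcongr with t
        have h1 := hlevel 1 t one_ne_zero ENNReal.one_ne_top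
        simp only [inv_one, one_mul] at h1
        rw [hlevel c t hc0 hc', h1,
          withDensity_apply _ (measurableSet_lt measurable_const hwm)]
        exact setLIntegral_superlevel_le ha hK hB hB' _
    _ = _ := by
        rw [lintegral_const_mul' _ _ (by finiteness),
          ← lintegral_eq_lintegral_measure_superlevel _ (by fun_prop), mul_assoc (c ^ p)]

/-- Local moment estimates: by induction on the exponent, starting from the energy estimate; for
real `p` the bound `t ^ p ≤ 1 + t ^ N` with `N = ⌈p⌉` is used. -/
theorem exists_setLIntegral_kernelPotential_rpow_le (ha : 0 < a) [SFinite σ]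
    (hK : ∀ S, σ S ≠ ∞ → ∫⁻ x in S, kernelPotential a (σ.restrict S) x ∂σ ≤ K * σ S)
    {p : ℝ} (hp : 0 ≤ p) :
    ∃ M : ℝ≥0, ∀ B, MeasurableSet B → σ B ≠ ∞ →
      ∫⁻ x in B, kernelPotential a (σ.restrict B) x ^ p ∂σ ≤ M * σ B := by
  have hnat : ∀ N : ℕ, ∃ M : ℝ≥0, ∀ B, MeasurableSet B → σ B ≠ ∞ →
      ∫⁻ x in B, kernelPotential a (σ.restrict B) x ^ (N : ℝ) ∂σ ≤ M * σ B := by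
    intro N
    induction N with
    | zero => exact ⟨1, fun B _ _ => by simp⟩
    | succ N ih =>
      obtain ⟨M, hM⟩ := ih
      rcases N.eq_zero_or_pos with rfl | hN
      · exact ⟨K, fun B _ hB' => by simpa using hK B hB'⟩
      · refine ⟨((2 * 3 ^ a) ^ (N : ℝ) * (2 * K)) * M, fun B hB hB' => ?_⟩
        have h := setLIntegral_kernelPotential_rpow_add_one_le ha hK hB hB'
          (p := N) (by exact_mod_cast hN)
        push_cast
        refine h.trans ?_
        rw [ENNReal.coe_rpow_of_nonneg _ (Nat.cast_nonneg N), ENNReal.coe_mul,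
          ENNReal.coe_rpow_of_nonneg _ ha.le, mul_assoc _ (M : ℝ≥0∞)]
        push_cast
        gcongr
        exact hM B hB hB'
  obtain ⟨M, hM⟩ := hnat ⌈p⌉₊
  refine ⟨1 + M, fun B hB hB' => ?_⟩
  calc ∫⁻ x in B, kernelPotential a (σ.restrict B) x ^ p ∂σ
      ≤ ∫⁻ x in B, (1 + kernelPotential a (σ.restrict B) x ^ (⌈p⌉₊ : ℝ)) ∂σ := by
        refine lintegral_mono fun x => ?_
        rcases le_total (kernelPotential a (σ.restrict B) x) 1 with h | h
        · exact (ENNReal.rpow_le_one h hp).trans le_self_add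
        · exact (ENNReal.rpow_le_rpow_of_exponent_le h (Nat.le_ceil p)).trans le_add_self
    _ = σ B + ∫⁻ x in B, kernelPotential a (σ.restrict B) x ^ (⌈p⌉₊ : ℝ) ∂σ := by
        rw [lintegral_add_left measurable_const]; simp
    _ ≤ σ B + M * σ B := by gcongr; exact hM B hB hB'
    _ = _ := by push_cast; ring

/-- Pointwise upper bound of Brezis–Kamin type. On each ball centred at `x` the potential of `σ` is,
up to a multiple of its value at `x`, the potential of the restriction of `σ` to the double ball,
whose moments are controlled; the balls are the superlevel sets of the kernel. -/
theorem exists_kernelPotential_withDensity_rpow_le (ha : 0 < a) [SFinite σ]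
    (hK : ∀ S, σ S ≠ ∞ → ∫⁻ x in S, kernelPotential a (σ.restrict S) x ∂σ ≤ K * σ S)
    {p : ℝ} (hp : 0 ≤ p) :
    ∃ C : ℝ≥0, ∀ x,
      kernelPotential a (σ.withDensity fun y => kernelPotential a σ y ^ p) x ≤
        C * (kernelPotential a σ x + kernelPotential a σ x ^ (p + 1)) := by
  obtain ⟨M, hM⟩ := exists_setLIntegral_kernelPotential_rpow_le ha hK hp
  set W := kernelPotential a σ with hW
  have hWm : Measurable W := measurable_kernelPotential _
  have h2a : (2 : ℝ≥0∞) ^ a ≠ ∞ := ENNReal.rpow_ne_top_of_nonneg ha.le (by norm_num)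
  have h2p : (2 : ℝ≥0∞) ^ p ≠ ∞ := ENNReal.rpow_ne_top_of_nonneg hp (by norm_num)
  have h2ap : ((2 : ℝ≥0∞) ^ a) ^ p ≠ ∞ := ENNReal.rpow_ne_top_of_nonneg hp h2a
  set c : ℝ≥0∞ := 1 + 2 ^ p * (M * 2 ^ a + (2 ^ a) ^ p) with hc
  have hc' : c ≠ ∞ := by finiteness
  refine ⟨c.toNNReal, fun x => ?_⟩
  rw [ENNReal.coe_toNNReal hc']
  rcases eq_or_ne (W x) ∞ with hx | hx
  · have : c ≠ 0 := by simp [hc]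
    simp [hx, ENNReal.mul_top this]
  have hkm : Measurable (rieszKernel a x) := measurable_rieszKernel_right x
  have hball : ∀ t : ℝ, 0 < t →
      σ.withDensity (fun y => W y ^ p) {y | ENNReal.ofReal t < rieszKernel a x y} ≤
        2 ^ p * (M * σ {y | ENNReal.ofReal t < 2 ^ a * rieszKernel a x y} +
          (2 ^ a * W x) ^ p * σ {y | ENNReal.ofReal t < rieszKernel a x y}) := by
    intro t ht
    set B := {y | ENNReal.ofReal t < rieszKernel a x y} with hB
    set D := {y | ENNReal.ofReal t < 2 ^ a * rieszKernel a x y} with hD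
    have hBm : MeasurableSet B := measurableSet_lt measurable_const hkm
    have hDm : MeasurableSet D := measurableSet_lt measurable_const (hkm.const_mul _)
    have hBD : B ⊆ D := by
      intro y (hy : ENNReal.ofReal t < rieszKernel a x y)
      refine hy.trans_le (le_mul_of_one_le_left' ?_)
      exact ENNReal.one_le_rpow (by norm_num) ha
    have hDfin : σ D ≠ ∞ := by
      have h1 := mul_meas_ge_le_lintegral₀ (μ := σ) (hkm.const_mul (2 ^ a)).aemeasurable
        (ENNReal.ofReal t)
      rw [lintegral_const_mul _ hkm] at h1
      have h2 : ENNReal.ofReal t * σ D ≤ 2 ^ a * W x := by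
        refine le_trans ?_ h1
        refine mul_le_mul' le_rfl (measure_mono fun y hy => ?_)
        exact le_of_lt (show ENNReal.ofReal t < 2 ^ a * rieszKernel a x y from hy)
      intro h
      rw [h, ENNReal.mul_top (ENNReal.ofReal_pos.2 ht).ne', top_le_iff] at h2
      exact ENNReal.mul_ne_top h2a hx h2
    have hfar : ∀ y ∈ B, W y ≤ kernelPotential a (σ.restrict D) y + 2 ^ a * W x := by
      intro y hy
      have hz : ∀ z ∈ Dᶜ, rieszKernel a y z ≤ 2 ^ a * rieszKernel a x z := by
        intro z hz
        have h1 : 2 * edist x y ≤ edist x z := by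
          by_contra! hlt
          have h2 := rieszKernel_le_of_edist_le ha two_ne_zero ENNReal.ofNat_ne_top hlt.le
          exact hz (lt_of_lt_of_le hy h2)
        refine rieszKernel_le_of_edist_le ha two_ne_zero ENNReal.ofNat_ne_top ?_
        have h3 : edist x z + edist x z ≤ edist x z + 2 * edist y z := by
          calc edist x z + edist x z = 2 * edist x z := (two_mul _).symm
            _ ≤ 2 * (edist x y + edist y z) := by gcongr; exact edist_triangle _ _ _
            _ = 2 * edist x y + 2 * edist y z := mul_add _ _ _
            _ ≤ _ := by gcongr
        exact (ENNReal.add_le_add_iff_left (edist_ne_top x z)).1 h3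
      calc W y = kernelPotential a (σ.restrict D) y + ∫⁻ z in Dᶜ, rieszKernel a y z ∂σ :=
            (lintegral_add_compl _ hDm).symm
        _ ≤ kernelPotential a (σ.restrict D) y +
            ∫⁻ z in Dᶜ, 2 ^ a * rieszKernel a x z ∂σ :=
          add_le_add le_rfl (setLIntegral_mono' hDm.compl hz)
        _ ≤ kernelPotential a (σ.restrict D) y + ∫⁻ z, 2 ^ a * rieszKernel a x z ∂σ :=
          add_le_add le_rfl (setLIntegral_le_lintegral _ _)
        _ = _ := by rw [lintegral_const_mul _ hkm]; rfl
    calc σ.withDensity (fun y => W y ^ p) B = ∫⁻ y in B, W y ^ p ∂σ := withDensity_apply _ hBm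
      _ ≤ ∫⁻ y in B, 2 ^ p * (kernelPotential a (σ.restrict D) y ^ p + (2 ^ a * W x) ^ p) ∂σ :=
          setLIntegral_mono' hBm fun y hy =>
            (ENNReal.rpow_le_rpow (hfar y hy) hp).trans (ENNReal.add_rpow_le_two_rpow_mul _ _ hp)
      _ = 2 ^ p * (∫⁻ y in B, kernelPotential a (σ.restrict D) y ^ p ∂σ +
            (2 ^ a * W x) ^ p * σ B) := by
          rw [lintegral_const_mul' _ _ h2p, lintegral_add_right _ measurable_const,
            setLIntegral_const]
      _ ≤ 2 ^ p * (∫⁻ y in D, kernelPotential a (σ.restrict D) y ^ p ∂σ +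
            (2 ^ a * W x) ^ p * σ B) := by
          gcongr
      _ ≤ _ := by gcongr; exact hM D hDm hDfin
  have hWp' : (2 ^ a * W x) ^ p ≠ ∞ := ENNReal.rpow_ne_top_of_nonneg hp (by finiteness)
  calc kernelPotential a (σ.withDensity fun y => W y ^ p) x
      = ∫⁻ t in Set.Ioi (0 : ℝ), σ.withDensity (fun y => W y ^ p)
          {y | ENNReal.ofReal t < rieszKernel a x y} :=
        lintegral_eq_lintegral_measure_superlevel _ hkm
    _ ≤ ∫⁻ t in Set.Ioi (0 : ℝ),
        2 ^ p * (M * σ {y | ENNReal.ofReal t < 2 ^ a * rieszKernel a x y} +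
          (2 ^ a * W x) ^ p * σ {y | ENNReal.ofReal t < rieszKernel a x y}) :=
        setLIntegral_mono' measurableSet_Ioi hball
    _ = 2 ^ p * (M * (2 ^ a * W x) + (2 ^ a * W x) ^ p * W x) := by
        have hanti : Measurable fun t : ℝ =>
            σ {y | ENNReal.ofReal t < rieszKernel a x y} :=
          Antitone.measurable fun s t hst => measure_mono fun y (hy : _ < _) =>
            (ENNReal.ofReal_le_ofReal hst).trans_lt hy
        rw [lintegral_const_mul' _ _ h2p, lintegral_add_right _ (hanti.const_mul _),
          lintegral_const_mul' _ _ ENNReal.coe_ne_top, lintegral_const_mul' _ _ hWp',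
          ← lintegral_eq_lintegral_measure_superlevel _ hkm,
          ← lintegral_eq_lintegral_measure_superlevel _ (hkm.const_mul _),
          lintegral_const_mul _ hkm]
        rfl
    _ = 2 ^ p * (M * 2 ^ a * W x + (2 ^ a) ^ p * W x ^ (p + 1)) := by
        rw [ENNReal.mul_rpow_of_nonneg _ _ hp, ENNReal.rpow_add_of_nonneg _ _ hp zero_le_one,
          ENNReal.rpow_one]
        ring
    _ ≤ 2 ^ p * ((M * 2 ^ a + (2 ^ a) ^ p) * W x + (M * 2 ^ a + (2 ^ a) ^ p) * W x ^ (p + 1)) := by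
        gcongr
        · exact le_self_add
        · exact le_add_self
    _ = 2 ^ p * (M * 2 ^ a + (2 ^ a) ^ p) * (W x + W x ^ (p + 1)) := by ring
    _ ≤ _ := by gcongr; exact le_add_self

end UpperBound

/-! ### Lower bound for the potential of a power of the potential -/

section LowerBound

/-- A continuous form of `Σ_k k ^ p ≥ c N ^ (p + 1)`: the tail of `μ` beyond `ρ y` is at least a
quarter of the total mass for all `y` outside a set of at most half of the mass. -/
theorem measure_univ_rpow_add_one_le_of_isFiniteMeasure {X : Type*} [MeasurableSpace X]
    (μ : Measure X) [IsFiniteMeasure μ] {ρ : X → ℝ≥0∞} (hρ : Measurable ρ) {p : ℝ} (hp : 0 ≤ p) :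
    μ Set.univ ^ (p + 1) ≤ 2 * 4 ^ p * ∫⁻ y, μ {z | ρ y ≤ ρ z} ^ p ∂μ := by
  set M := μ Set.univ with hM
  set F : X → ℝ≥0∞ := fun y => μ {z | ρ y ≤ ρ z} with hF
  have hle : MeasurableSet {q : X × X | ρ q.1 ≤ ρ q.2} :=
    measurableSet_le (by fun_prop) (by fun_prop)
  have hFm : Measurable F := measurable_measure_prodMk_left hle
  set A : Set X := {y | F y < M / 4} with hA
  have hAm : MeasurableSet A := measurableSet_lt hFm measurable_const
  set g : X → X → ℝ≥0∞ := fun y z => {q : X × X | ρ q.1 ≤ ρ q.2}.indicator 1 (y, z) with hg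
  have hgm : Measurable fun q : X × X => g q.1 q.2 := measurable_one.indicator hle
  have hgy : ∀ y, ∫⁻ z in A, g y z ∂μ ≤ F y := by
    intro y
    have hy : MeasurableSet {z | ρ y ≤ ρ z} := measurableSet_le measurable_const hρ
    calc ∫⁻ z in A, g y z ∂μ ≤ ∫⁻ z, g y z ∂μ := setLIntegral_le_lintegral _ _
      _ = ∫⁻ z, {z | ρ y ≤ ρ z}.indicator 1 z ∂μ := rfl
      _ = F y := lintegral_indicator_one hy
  -- By symmetry, at least half of `A ×ˢ A` consists of pairs with `ρ y ≤ ρ z`.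
  have hsq : μ A * μ A ≤ μ A * (M / 2) := by
    calc μ A * μ A = ∫⁻ y in A, ∫⁻ z in A, 1 ∂μ ∂μ := by simp
      _ ≤ ∫⁻ y in A, ∫⁻ z in A, (g y z + g z y) ∂μ ∂μ := by
          gcongr with y z
          rcases le_total (ρ y) (ρ z) with h | h
          · have : g y z = 1 := Set.indicator_of_mem (s := {q : X × X | ρ q.1 ≤ ρ q.2}) h _
            rw [this]; exact le_self_add
          · have : g z y = 1 := Set.indicator_of_mem (s := {q : X × X | ρ q.1 ≤ ρ q.2}) h _
            rw [this]; exact le_add_self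
      _ = (∫⁻ y in A, ∫⁻ z in A, g y z ∂μ ∂μ) + ∫⁻ y in A, ∫⁻ z in A, g z y ∂μ ∂μ := by
          rw [← lintegral_add_left hgm.lintegral_prod_right']
          exact lintegral_congr fun y => lintegral_add_left (hgm.of_uncurry_left) _
      _ = 2 * ∫⁻ y in A, ∫⁻ z in A, g y z ∂μ ∂μ := by
          rw [two_mul, lintegral_lintegral_swap (f := fun y z => g z y)
            (hgm.comp measurable_swap).aemeasurable]
      _ ≤ 2 * ∫⁻ y in A, M / 4 ∂μ := by
          gcongr 2 * ?_
          exact setLIntegral_mono' hAm fun y (hy : F y < M / 4) => (hgy y).trans hy.le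
      _ = μ A * (M / 2) := by
          rw [setLIntegral_const, mul_comm (M / 4), mul_left_comm]
          congr 1
          rw [ENNReal.div_eq_inv_mul, ENNReal.div_eq_inv_mul, ← mul_assoc,
            show (4 : ℝ≥0∞) = 2 * 2 by norm_num,
            ENNReal.mul_inv (Or.inl two_ne_zero) (Or.inl ENNReal.ofNat_ne_top), ← mul_assoc,
            ENNReal.mul_inv_cancel two_ne_zero ENNReal.ofNat_ne_top, one_mul]
  have hAle : μ A ≤ M / 2 := by
    rcases eq_or_ne (μ A) 0 with h0 | h0
    · rw [h0]; exact zero_le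
    · exact (ENNReal.mul_le_mul_iff_right h0 (measure_ne_top _ _)).1 hsq
  have hAc : M / 2 ≤ μ Aᶜ := by
    have h1 : M / 2 + M / 2 ≤ M / 2 + μ Aᶜ := by
      rw [ENNReal.add_halves]
      calc M = μ A + μ Aᶜ := (measure_add_measure_compl hAm).symm
        _ ≤ _ := by gcongr
    exact (ENNReal.add_le_add_iff_left
      (ENNReal.div_ne_top (measure_ne_top _ _) two_ne_zero)).1 h1
  have h4 : (4 : ℝ≥0∞) ^ p ≠ 0 := (ENNReal.rpow_pos (by norm_num) (by norm_num)).ne'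
  have h4' : (4 : ℝ≥0∞) ^ p ≠ ∞ := ENNReal.rpow_ne_top_of_nonneg hp (by norm_num)
  calc M ^ (p + 1) = 2 * 4 ^ p * ((M / 4) ^ p * (M / 2)) := by
        rw [ENNReal.div_rpow_of_nonneg _ _ hp, ENNReal.rpow_add_of_nonneg _ _ hp zero_le_one,
          ENNReal.rpow_one]
        calc M ^ p * M = (4 ^ p * (M ^ p / 4 ^ p)) * (2 * (M / 2)) := by
              rw [ENNReal.mul_div_cancel h4 h4',
                ENNReal.mul_div_cancel two_ne_zero ENNReal.ofNat_ne_top]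
          _ = _ := by ring
    _ ≤ 2 * 4 ^ p * ((M / 4) ^ p * μ Aᶜ) := by gcongr
    _ = 2 * 4 ^ p * ∫⁻ y in Aᶜ, (M / 4) ^ p ∂μ := by rw [setLIntegral_const]
    _ ≤ 2 * 4 ^ p * ∫⁻ y in Aᶜ, F y ^ p ∂μ := by
        gcongr 2 * 4 ^ p * ?_
        refine setLIntegral_mono' hAm.compl fun y hy => ENNReal.rpow_le_rpow ?_ hp
        exact not_lt.1 hy
    _ ≤ _ := by gcongr; exact Measure.restrict_le_self

theorem measure_univ_rpow_add_one_le {X : Type*} [MeasurableSpace X]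
    (μ : Measure X) [SigmaFinite μ] {ρ : X → ℝ≥0∞} (hρ : Measurable ρ) {p : ℝ} (hp : 0 ≤ p) :
    μ Set.univ ^ (p + 1) ≤ 2 * 4 ^ p * ∫⁻ y, μ {z | ρ y ≤ ρ z} ^ p ∂μ := by
  have hp1 : 0 < p + 1 := by linarith
  rw [← ENNReal.le_rpow_inv_iff hp1, ← iUnion_spanningSets μ,
    (monotone_spanningSets μ).measure_iUnion]
  refine iSup_le fun j => ?_
  rw [ENNReal.le_rpow_inv_iff hp1]
  have hfin : IsFiniteMeasure (μ.restrict (spanningSets μ j)) :=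
    ⟨by simpa using measure_spanningSets_lt_top μ j⟩
  have h := measure_univ_rpow_add_one_le_of_isFiniteMeasure (μ.restrict (spanningSets μ j)) hρ hp
  rw [Measure.restrict_apply_univ] at h
  refine h.trans ?_
  gcongr 2 * 4 ^ p * ?_
  refine lintegral_mono' Measure.restrict_le_self fun y => ENNReal.rpow_le_rpow ?_ hp
  exact Measure.restrict_apply_le _ _

variable {X : Type*} [MetricSpace X] [MeasurableSpace X] [BorelSpace X]
  [SecondCountableTopology X] {a : ℝ} {σ : Measure X}

/-- Pointwise lower bound. The potential at `y` dominates the mass which the measure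
`rieszKernel a x • σ` gives to the points lying at least as far from `x` as `y` does. -/
theorem kernelPotential_rpow_add_one_le (ha : 0 < a) [SigmaFinite σ] {p : ℝ} (hp : 0 ≤ p) (x : X) :
    kernelPotential a σ x ^ (p + 1) ≤ 2 * 4 ^ p * (2 ^ a) ^ p *
      kernelPotential a (σ.withDensity fun y => kernelPotential a σ y ^ p) x := by
  set W := kernelPotential a σ with hW
  have hWm : Measurable W := measurable_kernelPotential _
  have hkm : Measurable (rieszKernel a x) := measurable_rieszKernel_right x
  have h2a : (2 : ℝ≥0∞) ^ a ≠ ∞ := ENNReal.rpow_ne_top_of_nonneg ha.le (by norm_num)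
  rw [kernelPotential_withDensity _ (by fun_prop)]
  rcases eq_or_ne (σ {x}) 0 with hx | hx
  -- without an atom at `x` the kernel is finite `σ`-almost everywhere
  · set ν := σ.withDensity (rieszKernel a x) with hν
    have hfin : ∀ᵐ y ∂σ, rieszKernel a x y ≠ ∞ := by
      have : ∀ᵐ y ∂σ, y ≠ x := by
        rw [ae_iff]; simpa using hx
      filter_upwards [this] with y hy
      rw [rieszKernel, Ne, ENNReal.inv_eq_top, ENNReal.rpow_eq_zero_iff]
      simp [edist_eq_zero, hy.symm, ha.not_gt]
    have hsf : SigmaFinite ν := SigmaFinite.withDensity_of_ne_top hfin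
    have hWν : W x = ν Set.univ := by
      rw [hν, withDensity_apply _ MeasurableSet.univ, Measure.restrict_univ]; rfl
    have hρ : Measurable fun y => edist x y := by fun_prop
    have htail : ∀ y, ν {z | edist x y ≤ edist x z} ≤ 2 ^ a * W y := by
      intro y
      have hm : MeasurableSet {z | edist x y ≤ edist x z} :=
        measurableSet_le measurable_const hρ
      calc ν {z | edist x y ≤ edist x z}
          = ∫⁻ z in {z | edist x y ≤ edist x z}, rieszKernel a x z ∂σ := withDensity_apply _ hm
        _ ≤ ∫⁻ z in {z | edist x y ≤ edist x z}, 2 ^ a * rieszKernel a y z ∂σ := by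
            refine setLIntegral_mono' hm fun z (hz : edist x y ≤ edist x z) => ?_
            refine rieszKernel_le_of_edist_le ha two_ne_zero ENNReal.ofNat_ne_top ?_
            calc edist y z ≤ edist y x + edist x z := edist_triangle _ _ _
              _ ≤ edist x z + edist x z := by rw [edist_comm y x]; gcongr
              _ = 2 * edist x z := (two_mul _).symm
        _ ≤ ∫⁻ z, 2 ^ a * rieszKernel a y z ∂σ := setLIntegral_le_lintegral _ _
        _ = 2 ^ a * W y := lintegral_const_mul' _ _ h2a
    calc W x ^ (p + 1) ≤ 2 * 4 ^ p * ∫⁻ y, ν {z | edist x y ≤ edist x z} ^ p ∂ν := by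
          rw [hWν]; exact measure_univ_rpow_add_one_le ν hρ hp
      _ ≤ 2 * 4 ^ p * ∫⁻ y, (2 ^ a * W y) ^ p ∂ν := by
          gcongr with y
          exact htail y
      _ = 2 * 4 ^ p * ((2 ^ a) ^ p * ∫⁻ y, W y ^ p * rieszKernel a x y ∂σ) := by
          congr 1
          simp_rw [ENNReal.mul_rpow_of_nonneg _ _ hp]
          rw [lintegral_const_mul _ (by fun_prop), hν,
            lintegral_withDensity_eq_lintegral_mul _ hkm (by fun_prop)]
          simp_rw [Pi.mul_apply, mul_comm]
      _ = _ := by ring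
  -- an atom of `σ` at `x` makes both sides infinite
  · have hat : ∀ g : X → ℝ≥0∞, g x * σ {x} ≤ ∫⁻ y, g y ∂σ := by
      intro g
      rw [← lintegral_singleton]
      exact setLIntegral_le_lintegral _ _
    have hWx : W x = ∞ := by
      have := hat (rieszKernel a x)
      rw [rieszKernel_self ha, ENNReal.top_mul hx, top_le_iff] at this
      exact this
    have hR : ∫⁻ y, W y ^ p * rieszKernel a x y ∂σ = ∞ := by
      have := hat fun y => W y ^ p * rieszKernel a x y
      have h0 : (∞ : ℝ≥0∞) ^ p ≠ 0 := by
        rcases hp.eq_or_lt with rfl | h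
        · simp
        · simp [h]
      rw [rieszKernel_self ha, hWx, ENNReal.mul_top h0, ENNReal.top_mul hx, top_le_iff] at this
      exact this
    have h4 : (4 : ℝ≥0∞) ^ p ≠ 0 := (ENNReal.rpow_pos (by norm_num) (by norm_num)).ne'
    have h2 : ((2 : ℝ≥0∞) ^ a) ^ p ≠ 0 :=
      (ENNReal.rpow_pos (ENNReal.rpow_pos (by norm_num) (by norm_num)) h2a).ne'
    rw [hR, ENNReal.mul_top (mul_ne_zero (mul_ne_zero two_ne_zero h4) h2)]
    exact le_top

end LowerBound

/-! ### Averages of potentials over large balls -/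

section Averages

variable {n : ℕ} {a : ℝ}

/-- Layer cake formula for the kernel, whose superlevel sets are balls around `y`: they are measured
by the volume of `Metric.ball x₀ R` below the level `R ^ (-a)` and by their own volume above. -/
theorem exists_lintegral_ball_rieszKernel_le_rpow (ha : 0 < a) (han : a < n) :
    ∃ A : ℝ≥0, ∀ R : ℝ, 0 < R → ∀ x₀ y : EuclideanSpace ℝ (Fin n),
      ∫⁻ x in Metric.ball x₀ R, rieszKernel a x y ≤ A * ENNReal.ofReal (R ^ ((n : ℝ) - a)) := by
  set V : ℝ≥0∞ := volume (Metric.ball (0 : EuclideanSpace ℝ (Fin n)) 1) with hV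
  have hV' : V ≠ ∞ := measure_ball_lt_top.ne
  have hvol : ∀ (x : EuclideanSpace ℝ (Fin n)) {r : ℝ}, 0 < r →
      volume (Metric.ball x r) = ENNReal.ofReal (r ^ (n : ℝ)) * V := by
    intro x r hr
    rw [Measure.addHaar_ball_of_pos _ _ hr, finrank_euclideanSpace_fin, Real.rpow_natCast]
  set A : ℝ≥0∞ := V + V * ENNReal.ofReal (((n : ℝ) / a - 1)⁻¹) with hA
  have hA' : A ≠ ∞ := by finiteness
  have hna : 1 < (n : ℝ) / a := by rwa [lt_div_iff₀ ha, one_mul]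
  refine ⟨A.toNNReal, fun R hR x₀ y => ?_⟩
  rw [ENNReal.coe_toNNReal hA']
  have hkm : Measurable fun x => rieszKernel a x y := (continuous_rieszKernel_left y).measurable
  set l : ℝ := R ^ (-a) with hl
  have hl0 : 0 < l := Real.rpow_pos_of_pos hR _
  have hsub : ∀ t : ℝ, 0 < t →
      volume {x | ENNReal.ofReal t < rieszKernel a x y} ≤ ENNReal.ofReal t ^ (-(n : ℝ) / a) * V := by
    intro t ht
    have hr : 0 < (t⁻¹) ^ a⁻¹ := Real.rpow_pos_of_pos (inv_pos.2 ht) _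
    have h1 : {x | ENNReal.ofReal t < rieszKernel a x y} ⊆ Metric.ball y ((t⁻¹) ^ a⁻¹) := by
      intro x (hx : ENNReal.ofReal t < (edist x y ^ a)⁻¹)
      rw [ENNReal.lt_inv_iff_lt_inv, ← ENNReal.lt_rpow_inv_iff ha,
        ← ENNReal.ofReal_inv_of_pos ht, ENNReal.ofReal_rpow_of_pos (inv_pos.2 ht)] at hx
      rwa [← Metric.eball_ofReal, Metric.mem_eball]
    refine (measure_mono h1).trans (le_of_eq ?_)
    rw [hvol y hr, ENNReal.ofReal_rpow_of_pos ht, ← Real.rpow_mul (inv_pos.2 ht).le,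
      Real.inv_rpow ht.le, ← Real.rpow_neg ht.le]
    congr 3
    field_simp
  have hmono : ∀ t, volume.restrict (Metric.ball x₀ R) {x | ENNReal.ofReal t < rieszKernel a x y} ≤
      volume {x | ENNReal.ofReal t < rieszKernel a x y} := fun t => Measure.restrict_apply_le _ _
  calc ∫⁻ x in Metric.ball x₀ R, rieszKernel a x y
      = ∫⁻ t in Set.Ioi (0 : ℝ), volume.restrict (Metric.ball x₀ R)
          {x | ENNReal.ofReal t < rieszKernel a x y} :=
        lintegral_eq_lintegral_measure_superlevel _ hkm
    _ ≤ (∫⁻ t in Set.Ioc (0 : ℝ) l, volume.restrict (Metric.ball x₀ R)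
          {x | ENNReal.ofReal t < rieszKernel a x y}) +
        ∫⁻ t in Set.Ioi l, volume.restrict (Metric.ball x₀ R)
          {x | ENNReal.ofReal t < rieszKernel a x y} := by
        rw [← Set.Ioc_union_Ioi_eq_Ioi hl0.le]
        exact lintegral_union_le _ _ _
    _ ≤ (∫⁻ t in Set.Ioc (0 : ℝ) l, volume (Metric.ball x₀ R)) +
        ∫⁻ t in Set.Ioi l, ENNReal.ofReal t ^ (-(n : ℝ) / a) * V := by
        refine add_le_add (lintegral_mono fun t => ?_)
          (setLIntegral_mono' measurableSet_Ioi fun t (ht : l < t) =>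
            (hmono t).trans (hsub t (hl0.trans ht)))
        exact (measure_mono (Set.subset_univ _)).trans (by simp)
    _ = V * ENNReal.ofReal (R ^ ((n : ℝ) - a)) +
        V * ENNReal.ofReal (((n : ℝ) / a - 1)⁻¹) * ENNReal.ofReal (R ^ ((n : ℝ) - a)) := by
        congr 1
        · rw [setLIntegral_const, Real.volume_Ioc, sub_zero, hvol x₀ hR, mul_comm (ENNReal.ofReal _) V,
            mul_assoc, ← ENNReal.ofReal_mul (Real.rpow_pos_of_pos hR _).le, hl,
            ← Real.rpow_add hR, sub_eq_add_neg]
        · rw [lintegral_mul_const' _ _ hV',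
            lintegral_Ioi_ofReal_rpow hl0 (by rw [neg_div]; linarith), mul_comm, mul_assoc,
            ← ENNReal.ofReal_mul (inv_pos.2 (by linarith)).le, hl, ← Real.rpow_mul hR.le]
          congr 2
          have h1 : -a * (-(n : ℝ) / a + 1) = n - a := by field_simp; ring
          have h2 : (n : ℝ) / a - 1 ≠ 0 := by linarith
          have h3 : -(n : ℝ) / a + 1 = -((n : ℝ) / a - 1) := by ring
          rw [h1, h3, neg_div_neg_eq, div_eq_mul_inv, mul_comm]
    _ = A * ENNReal.ofReal (R ^ ((n : ℝ) - a)) := by rw [hA, add_mul]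

/-- The average of the kernel over a ball is controlled by the kernel at its centre, truncated at
the height `R ^ (-a)` given by the radius. -/
theorem exists_lintegral_ball_rieszKernel_le (ha : 0 < a) (han : a < n) :
    ∃ A : ℝ≥0, ∀ R : ℝ, 0 < R → ∀ x₀ y : EuclideanSpace ℝ (Fin n),
      ∫⁻ x in Metric.ball x₀ R, rieszKernel a x y ≤
        A * ENNReal.ofReal R ^ n * min (ENNReal.ofReal (R ^ (-a))) (rieszKernel a x₀ y) := by
  obtain ⟨A, hA⟩ := exists_lintegral_ball_rieszKernel_le_rpow ha han
  set V : ℝ≥0∞ := volume (Metric.ball (0 : EuclideanSpace ℝ (Fin n)) 1) with hV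
  have hV' : V ≠ ∞ := measure_ball_lt_top.ne
  have h2a : (2 : ℝ≥0∞) ^ a ≠ ∞ := ENNReal.rpow_ne_top_of_nonneg ha.le (by norm_num)
  have h2a' : (1 : ℝ≥0∞) ≤ 2 ^ a := ENNReal.one_le_rpow (by norm_num) ha
  set A' : ℝ≥0∞ := 2 ^ a * (A + V) with hA'
  have hA'' : A' ≠ ∞ := by finiteness
  refine ⟨A'.toNNReal, fun R hR x₀ y => ?_⟩
  rw [ENNReal.coe_toNNReal hA'']
  have h1 : ∫⁻ x in Metric.ball x₀ R, rieszKernel a x y ≤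
      A * ENNReal.ofReal R ^ n * ENNReal.ofReal (R ^ (-a)) := by
    refine (hA R hR x₀ y).trans (le_of_eq ?_)
    rw [← ENNReal.ofReal_pow hR.le, mul_assoc, ← ENNReal.ofReal_mul (by positivity),
      ← Real.rpow_natCast, ← Real.rpow_add hR, sub_eq_add_neg]
  rw [← min_mul_mul_left]
  refine le_min (h1.trans ?_) ?_
  · gcongr
    calc (A : ℝ≥0∞) ≤ 1 * (A + V) := by rw [one_mul]; exact le_self_add
      _ ≤ _ := by rw [hA']; gcongr
  rcases lt_or_ge (edist x₀ y) (2 * ENNReal.ofReal R) with hy | hy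
  · have h2 : ENNReal.ofReal (R ^ (-a)) ≤ 2 ^ a * rieszKernel a x₀ y := by
      have h3 : edist x₀ y ^ a ≤ 2 ^ a * ENNReal.ofReal R ^ a := by
        rw [← ENNReal.mul_rpow_of_nonneg _ _ ha.le]
        exact ENNReal.rpow_le_rpow hy.le ha.le
      have h20 : (2 : ℝ≥0∞) ^ a ≠ 0 := (one_pos.trans_le h2a').ne'
      have h4 := ENNReal.inv_le_inv.2 h3
      rw [ENNReal.mul_inv (Or.inl h20) (Or.inl h2a)] at h4
      rw [← ENNReal.ofReal_rpow_of_pos hR, ENNReal.rpow_neg]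
      calc (ENNReal.ofReal R ^ a)⁻¹
          = 2 ^ a * ((2 ^ a)⁻¹ * (ENNReal.ofReal R ^ a)⁻¹) := by
            rw [← mul_assoc, ENNReal.mul_inv_cancel h20 h2a, one_mul]
        _ ≤ _ := by gcongr; exact h4
    calc _ ≤ A * ENNReal.ofReal R ^ n * ENNReal.ofReal (R ^ (-a)) := h1
      _ ≤ A * ENNReal.ofReal R ^ n * (2 ^ a * rieszKernel a x₀ y) := by gcongr
      _ = 2 ^ a * A * ENNReal.ofReal R ^ n * rieszKernel a x₀ y := by ring
      _ ≤ _ := by rw [hA']; gcongr; exact le_self_add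
  · calc ∫⁻ x in Metric.ball x₀ R, rieszKernel a x y
        ≤ ∫⁻ x in Metric.ball x₀ R, 2 ^ a * rieszKernel a x₀ y := by
          refine setLIntegral_mono' measurableSet_ball fun x hx => ?_
          refine rieszKernel_le_of_edist_le ha two_ne_zero ENNReal.ofNat_ne_top ?_
          have hx' : edist x x₀ < ENNReal.ofReal R := by
            rwa [← Metric.mem_eball, Metric.eball_ofReal]
          have h5 : edist x₀ y ≤ ENNReal.ofReal R + edist x y := by
            refine (edist_triangle x₀ x y).trans ?_
            rw [edist_comm x₀ x]
            gcongr
          have h6 : ENNReal.ofReal R ≤ edist x y := by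
            refine (ENNReal.add_le_add_iff_left (ENNReal.ofReal_ne_top (r := R))).1 ?_
            rw [← two_mul]
            exact hy.trans h5
          refine h5.trans ?_
          rw [two_mul]
          gcongr
      _ = 2 ^ a * V * ENNReal.ofReal R ^ n * rieszKernel a x₀ y := by
          rw [setLIntegral_const, Measure.addHaar_ball_of_pos _ _ hR,
            finrank_euclideanSpace_fin, ENNReal.ofReal_pow hR.le]
          ring
      _ ≤ _ := by rw [hA']; gcongr; exact le_add_self

theorem exists_lintegral_ball_kernelPotential_le (ha : 0 < a) (han : a < n) :
    ∃ A : ℝ≥0, ∀ (ω : Measure (EuclideanSpace ℝ (Fin n))) [SFinite ω], ∀ R : ℝ, 0 < R → ∀ x₀,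
      ∫⁻ x in Metric.ball x₀ R, kernelPotential a ω x ≤ A * ENNReal.ofReal R ^ n *
        ∫⁻ y, min (ENNReal.ofReal (R ^ (-a))) (rieszKernel a x₀ y) ∂ω := by
  obtain ⟨A, hA⟩ := exists_lintegral_ball_rieszKernel_le ha han
  refine ⟨A, fun ω _ R hR x₀ => ?_⟩
  unfold kernelPotential
  rw [lintegral_lintegral_swap measurable_rieszKernel.aemeasurable,
    ← lintegral_const_mul' _ _ (by finiteness)]
  exact lintegral_mono fun y => hA R hR x₀ y

/-- A potential which is finite at one point is locally integrable. -/
theorem ae_kernelPotential_lt_top (ha : 0 < a) (han : a < n)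
    (ω : Measure (EuclideanSpace ℝ (Fin n))) [SFinite ω]
    (h : ∃ x, kernelPotential a ω x < ∞) : ∀ᵐ x, kernelPotential a ω x < ∞ := by
  obtain ⟨A, hA⟩ := exists_lintegral_ball_kernelPotential_le ha han
  obtain ⟨x₀, hx₀⟩ := h
  have hj : ∀ j : ℕ, ∀ᵐ x ∂(volume.restrict (Metric.ball x₀ ((j : ℝ) + 1))),
      kernelPotential a ω x < ∞ := by
    intro j
    refine ae_lt_top (measurable_kernelPotential _) (ne_top_of_le_ne_top ?_
      (hA ω _ (by positivity : (0 : ℝ) < (j : ℝ) + 1) x₀))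
    have : ∫⁻ y, min (ENNReal.ofReal (((j : ℝ) + 1) ^ (-a))) (rieszKernel a x₀ y) ∂ω ≠ ∞ :=
      ((lintegral_mono fun y => min_le_right _ _).trans_lt hx₀).ne
    finiteness
  have hU : (⋃ j : ℕ, Metric.ball x₀ ((j : ℝ) + 1)) = Set.univ :=
    Set.eq_univ_of_forall fun x => Set.mem_iUnion.2 <| by
      obtain ⟨j, hj⟩ := exists_nat_gt (dist x x₀)
      exact ⟨j, Metric.mem_ball.2 (hj.trans (lt_add_one _))⟩
  rw [← Measure.restrict_univ (μ := volume), ← hU]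
  exact (ae_restrict_iUnion_iff _ _).2 hj

/-- A potential which is finite at one point has averages tending to zero over large balls, so it
is not bounded away from zero at infinity. -/
theorem liminf_kernelPotential_cocompact (ha : 0 < a) (han : a < n)
    (ω : Measure (EuclideanSpace ℝ (Fin n))) [SFinite ω]
    (h : ∃ x, kernelPotential a ω x < ∞) :
    liminf (kernelPotential a ω) (cocompact (EuclideanSpace ℝ (Fin n))) = 0 := by
  obtain ⟨A, hA⟩ := exists_lintegral_ball_kernelPotential_le ha han
  obtain ⟨x₀, hx₀⟩ := h
  have hn : n ≠ 0 := by
    rintro rfl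
    simp only [Nat.cast_zero] at han
    linarith
  by_contra hne
  obtain ⟨ε, hε0, hε⟩ := exists_between (pos_iff_ne_zero.2 hne)
  have hε' : ε ≠ ∞ := hε.ne_top
  obtain ⟨R₀, hR₀⟩ := Metric.closedBall_compl_subset_of_mem_cocompact
    (eventually_lt_of_lt_liminf hε) x₀
  set V : ℝ≥0∞ := volume (Metric.ball (0 : EuclideanSpace ℝ (Fin n)) 1) with hV
  have hV0 : V ≠ 0 := (Metric.measure_ball_pos _ _ one_pos).ne'
  set v₀ := volume (Metric.closedBall x₀ R₀) with hv₀
  have hv₀' : v₀ ≠ ∞ := measure_closedBall_lt_top.ne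
  set η : ℕ → ℝ≥0∞ := fun j =>
    ∫⁻ y, min (ENNReal.ofReal ((j : ℝ) ^ (-a))) (rieszKernel a x₀ y) ∂ω with hη
  have hbound : ∀ j : ℕ, 0 < j → ε * V ≤ ε * v₀ * (j : ℝ≥0∞)⁻¹ + A * η j := by
    intro j hj
    have hjr : (0 : ℝ) < j := by exact_mod_cast hj
    have hj0 : ((j : ℝ≥0∞)) ^ n ≠ 0 := pow_ne_zero _ (by exact_mod_cast hj.ne')
    have hj' : ((j : ℝ≥0∞)) ^ n ≠ ∞ := ENNReal.pow_ne_top (ENNReal.natCast_ne_top j)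
    have h1 : ε * (V * (j : ℝ≥0∞) ^ n) ≤ ε * v₀ + A * (j : ℝ≥0∞) ^ n * η j := by
      calc ε * (V * (j : ℝ≥0∞) ^ n) = ε * volume (Metric.ball x₀ (j : ℝ)) := by
            rw [Measure.addHaar_ball_of_pos _ _ hjr, finrank_euclideanSpace_fin,
              ENNReal.ofReal_pow hjr.le, ENNReal.ofReal_natCast, mul_comm V]
        _ ≤ ε * (v₀ + volume (Metric.ball x₀ (j : ℝ) \ Metric.closedBall x₀ R₀)) := by
            gcongr
            refine (measure_mono fun x hx => ?_).trans (measure_union_le _ _)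
            by_cases hx' : x ∈ Metric.closedBall x₀ R₀
            · exact Or.inl hx'
            · exact Or.inr ⟨hx, hx'⟩
        _ = ε * v₀ + ∫⁻ x in Metric.ball x₀ (j : ℝ) \ Metric.closedBall x₀ R₀, ε := by
            rw [setLIntegral_const, mul_add]
        _ ≤ ε * v₀ + ∫⁻ x in Metric.ball x₀ (j : ℝ) \ Metric.closedBall x₀ R₀,
              kernelPotential a ω x := by
            refine add_le_add le_rfl (setLIntegral_mono'
              (measurableSet_ball.diff measurableSet_closedBall) fun x hx => ?_)
            exact le_of_lt (hR₀ hx.2)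
        _ ≤ ε * v₀ + ∫⁻ x in Metric.ball x₀ (j : ℝ), kernelPotential a ω x :=
            add_le_add le_rfl (lintegral_mono_set Set.sdiff_subset)
        _ ≤ _ := by
            have := hA ω j hjr x₀
            rw [ENNReal.ofReal_natCast] at this
            exact add_le_add le_rfl this
    calc ε * V = ε * (V * (j : ℝ≥0∞) ^ n) * ((j : ℝ≥0∞) ^ n)⁻¹ := by
          rw [mul_assoc, mul_assoc, ENNReal.mul_inv_cancel hj0 hj', mul_one]
      _ ≤ (ε * v₀ + A * (j : ℝ≥0∞) ^ n * η j) * ((j : ℝ≥0∞) ^ n)⁻¹ := by gcongr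
      _ = ε * v₀ * ((j : ℝ≥0∞) ^ n)⁻¹ + A * η j * ((j : ℝ≥0∞) ^ n * ((j : ℝ≥0∞) ^ n)⁻¹) := by
          ring
      _ ≤ _ := by
          rw [ENNReal.mul_inv_cancel hj0 hj', mul_one]
          gcongr
          exact le_self_pow (by exact_mod_cast hj) hn
  have hηlim : Tendsto η atTop (nhds 0) := by
    have h0 : (0 : ℝ≥0∞) = ∫⁻ y, 0 ∂ω := by simp
    rw [h0]
    refine tendsto_lintegral_of_dominated_convergence (rieszKernel a x₀)
      (fun j => measurable_const.min (measurable_rieszKernel_right x₀))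
      (fun j => Eventually.of_forall fun y => min_le_right _ _) hx₀.ne
      (Eventually.of_forall fun y => ?_)
    have h1 : Tendsto (fun j : ℕ => ENNReal.ofReal ((j : ℝ) ^ (-a))) atTop (nhds 0) := by
      rw [← ENNReal.ofReal_zero]
      exact ENNReal.tendsto_ofReal
        ((tendsto_rpow_neg_atTop ha).comp tendsto_natCast_atTop_atTop)
    exact tendsto_of_tendsto_of_tendsto_of_le_of_le tendsto_const_nhds h1
      (fun _ => zero_le) fun _ => min_le_left _ _
  have hlim : Tendsto (fun j : ℕ => ε * v₀ * (j : ℝ≥0∞)⁻¹ + A * η j) atTop (nhds 0) := by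
    have h1 := ENNReal.Tendsto.const_mul (a := ε * v₀) ENNReal.tendsto_inv_nat_nhds_zero
      (Or.inr (by finiteness))
    have h2 := ENNReal.Tendsto.const_mul (a := (A : ℝ≥0∞)) hηlim (Or.inr ENNReal.coe_ne_top)
    simpa using h1.add h2
  have hle : ε * V ≤ 0 := ge_of_tendsto hlim (by
    filter_upwards [eventually_gt_atTop 0] with j hj using hbound j hj)
  exact mul_ne_zero hε0.ne' hV0 (le_zero_iff.1 hle)

end Averages

/-! ### Sub- and supersolutions and monotone iteration -/

section System

theorem kernelPotential_withDensity_rpow_mono {X : Type*} [EDist X] [MeasurableSpace X] {a : ℝ}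
    {σ μ : Measure X} {q : ℝ} (hq : 0 ≤ q)
    {f g : X → ℝ≥0∞} (hfg : ∀ x, f x ≤ g x) (x : X) :
    kernelPotential a (σ.withDensity (fun y => f y ^ q) + μ) x ≤
      kernelPotential a (σ.withDensity (fun y => g y ^ q) + μ) x := by
  refine kernelPotential_mono (add_le_add ?_ le_rfl) x
  exact withDensity_mono (Eventually.of_forall fun y => ENNReal.rpow_le_rpow (hfg y) hq)

theorem eventually_mul_rpow_add_le (K D : ℝ≥0) {q : ℝ} (hq : 0 ≤ q) (hq' : q < 1) :
    ∀ᶠ b : ℝ≥0 in atTop, K * b ^ q + D ≤ b := by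
  have h1 : Tendsto (fun b : ℝ≥0 => b ^ (1 - q)) atTop atTop :=
    NNReal.tendsto_rpow_atTop (by linarith)
  filter_upwards [h1.eventually_ge_atTop (K + D), eventually_ge_atTop 1] with b hb hb1
  have h2 : 1 ≤ b ^ q := NNReal.one_le_rpow hb1 hq
  calc K * b ^ q + D ≤ K * b ^ q + D * b ^ q := by
        gcongr
        exact le_mul_of_one_le_right' h2
    _ = (K + D) * b ^ q := (add_mul _ _ _).symm
    _ ≤ b ^ (1 - q) * b ^ q := by gcongr
    _ = b := by
        rw [← NNReal.rpow_add (by positivity)]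
        simp

variable {X : Type*} [MetricSpace X] [MeasurableSpace X] [BorelSpace X]
  [SecondCountableTopology X] {a : ℝ} {σ : Measure X}

theorem kernelPotential_withDensity_const_mul (σ : Measure X) (c : ℝ≥0) {g : X → ℝ≥0∞}
    (hg : Measurable g) (x : X) :
    kernelPotential a (σ.withDensity fun y => c * g y) x =
      c * kernelPotential a (σ.withDensity g) x := by
  rw [kernelPotential_withDensity _ hg, kernelPotential_withDensity _ (by fun_prop),
    ← lintegral_const_mul' _ _ ENNReal.coe_ne_top]
  simp_rw [mul_assoc]

/-- For all large `b`, the function `b⁻¹ * W ^ γ'` on the right-hand side of an equation of the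
system yields at least `b⁻¹ * W ^ γ`, because the exponents satisfy `γ' * q + 1 = γ`. -/
theorem eventually_le_kernelPotential [SigmaFinite σ] (ha : 0 < a) {q γ γ' : ℝ} (hq : 0 < q)
    (hq' : q < 1) (hγ' : 0 ≤ γ') (hγ : γ' * q + 1 = γ) (μ : Measure X) :
    ∀ᶠ b : ℝ≥0 in atTop, ∀ x, (b : ℝ≥0∞)⁻¹ * kernelPotential a σ x ^ γ ≤
      kernelPotential a (σ.withDensity
        (fun y => ((b : ℝ≥0∞)⁻¹ * kernelPotential a σ y ^ γ') ^ q) + μ) x := by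
  have hp : 0 ≤ γ' * q := by positivity
  set W := kernelPotential a σ with hW
  have hWm : Measurable W := measurable_kernelPotential _
  obtain ⟨κ, hlow⟩ : ∃ κ : ℝ≥0, ∀ x, W x ^ γ ≤
      κ * kernelPotential a (σ.withDensity fun y => W y ^ (γ' * q)) x := by
    refine ⟨2 * 4 ^ (γ' * q) * (2 ^ a) ^ (γ' * q), fun x => ?_⟩
    have h := kernelPotential_rpow_add_one_le (σ := σ) ha hp x
    rw [hγ] at h
    refine h.trans (le_of_eq ?_)
    push_cast [ENNReal.coe_rpow_of_nonneg _ hp, ENNReal.coe_rpow_of_nonneg _ ha.le]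
    rfl
  filter_upwards [eventually_mul_rpow_add_le κ 0 hq.le hq', eventually_ge_atTop 1] with b hb hb1 x
  have hb0 : b ≠ 0 := (zero_lt_one.trans_le hb1).ne'
  have hcoef : b⁻¹ * κ ≤ b⁻¹ ^ q := by
    rw [add_zero] at hb
    rw [NNReal.inv_rpow, inv_mul_le_iff₀ (zero_lt_one.trans_le hb1), ← div_eq_mul_inv,
      le_div_iff₀ (NNReal.rpow_pos (zero_lt_one.trans_le hb1))]
    exact hb
  rw [← ENNReal.coe_inv hb0]
  have hfun : (fun y => (((b⁻¹ : ℝ≥0) : ℝ≥0∞) * W y ^ γ') ^ q) =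
      fun y => ((b⁻¹ ^ q : ℝ≥0) : ℝ≥0∞) * W y ^ (γ' * q) := by
    ext y
    rw [ENNReal.mul_rpow_of_nonneg _ _ hq.le, ← ENNReal.rpow_mul,
      ENNReal.coe_rpow_of_nonneg _ hq.le]
  rw [hfun, kernelPotential_add_measure,
    kernelPotential_withDensity_const_mul _ _ (by fun_prop : Measurable fun y => W y ^ (γ' * q))]
  refine le_trans ?_ le_self_add
  calc ((b⁻¹ : ℝ≥0) : ℝ≥0∞) * W x ^ γ
      ≤ (b⁻¹ : ℝ≥0) * (κ * kernelPotential a (σ.withDensity fun y => W y ^ (γ' * q)) x) := by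
        gcongr; exact hlow x
    _ = ((b⁻¹ * κ : ℝ≥0) : ℝ≥0∞) *
        kernelPotential a (σ.withDensity fun y => W y ^ (γ' * q)) x := by
        rw [ENNReal.coe_mul, mul_assoc]
    _ ≤ _ := by gcongr

/-- For all large `b`, the function `b * (W + W ^ γ')` on the right-hand side of an equation of the
system yields at most `b * (W + W ^ γ)`; the power `W ^ (q + 1)` which the linear term produces
lies between `W` and `W ^ γ`. -/
theorem eventually_kernelPotential_le [SFinite σ] (ha : 0 < a) {K : ℝ≥0}
    (hK : ∀ S, σ S ≠ ∞ → ∫⁻ x in S, kernelPotential a (σ.restrict S) x ∂σ ≤ K * σ S)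
    {q γ γ' : ℝ} (hq : 0 < q) (hq' : q < 1) (hγ'1 : 1 ≤ γ') (hγ : γ' * q + 1 = γ)
    {μ : Measure X} {D : ℝ≥0} (hμ : ∀ x, kernelPotential a μ x ≤ D * kernelPotential a σ x) :
    ∀ᶠ b : ℝ≥0 in atTop, ∀ x,
      kernelPotential a (σ.withDensity
        (fun y => (b * (kernelPotential a σ y + kernelPotential a σ y ^ γ')) ^ q) + μ) x ≤
      b * (kernelPotential a σ x + kernelPotential a σ x ^ γ) := by
  have hγ' : 0 ≤ γ' := zero_le_one.trans hγ'1
  have hp : 0 ≤ γ' * q := by positivity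
  obtain ⟨C₁, hC₁⟩ := exists_kernelPotential_withDensity_rpow_le ha hK hq.le
  obtain ⟨C₂, hC₂⟩ := exists_kernelPotential_withDensity_rpow_le ha hK hp
  set W := kernelPotential a σ with hW
  have hWm : Measurable W := measurable_kernelPotential _
  rw [hγ] at hC₂
  have hinterp : ∀ x, W x ^ (q + 1) ≤ W x + W x ^ γ := by
    intro x
    rcases le_total (W x) 1 with h | h
    · refine le_trans ?_ le_self_add
      calc W x ^ (q + 1) ≤ W x ^ (1 : ℝ) := ENNReal.rpow_le_rpow_of_exponent_ge h (by linarith)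
        _ = W x := ENNReal.rpow_one _
    · refine le_trans ?_ le_add_self
      refine ENNReal.rpow_le_rpow_of_exponent_le h ?_
      nlinarith
  set L : ℝ≥0 := 2 ^ q * (2 * C₁ + C₂) with hL
  filter_upwards [eventually_mul_rpow_add_le L D hq.le hq'] with b hb x
  have hdens : (fun y => (b * (W y + W y ^ γ')) ^ q) ≤
      fun y => ((b ^ q * 2 ^ q : ℝ≥0) : ℝ≥0∞) * (W y ^ q + W y ^ (γ' * q)) := by
    intro y
    change (b * (W y + W y ^ γ')) ^ q ≤
      ((b ^ q * 2 ^ q : ℝ≥0) : ℝ≥0∞) * (W y ^ q + W y ^ (γ' * q))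
    rw [ENNReal.mul_rpow_of_nonneg _ _ hq.le, ENNReal.coe_mul, ENNReal.coe_rpow_of_nonneg _ hq.le,
      ENNReal.coe_rpow_of_nonneg _ hq.le, mul_assoc, ENNReal.rpow_mul]
    gcongr
    exact ENNReal.add_rpow_le_two_rpow_mul _ _ hq.le
  have hsum : σ.withDensity (fun y => W y ^ q + W y ^ (γ' * q)) =
      σ.withDensity (fun y => W y ^ q) + σ.withDensity (fun y => W y ^ (γ' * q)) :=
    withDensity_add_left (by fun_prop) _
  rw [kernelPotential_add_measure]
  calc kernelPotential a (σ.withDensity fun y => (b * (W y + W y ^ γ')) ^ q) x +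
        kernelPotential a μ x
      ≤ kernelPotential a (σ.withDensity fun y =>
          ((b ^ q * 2 ^ q : ℝ≥0) : ℝ≥0∞) * (W y ^ q + W y ^ (γ' * q))) x + D * W x :=
        add_le_add (kernelPotential_mono (withDensity_mono (Eventually.of_forall hdens)) x) (hμ x)
    _ = ((b ^ q * 2 ^ q : ℝ≥0) : ℝ≥0∞) * (kernelPotential a (σ.withDensity fun y => W y ^ q) x +
          kernelPotential a (σ.withDensity fun y => W y ^ (γ' * q)) x) + D * W x := by
        rw [kernelPotential_withDensity_const_mul _ _
          (by fun_prop : Measurable fun y => W y ^ q + W y ^ (γ' * q)), hsum,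
          kernelPotential_add_measure]
    _ ≤ ((b ^ q * 2 ^ q : ℝ≥0) : ℝ≥0∞) * (C₁ * ((W x + W x ^ γ) + (W x + W x ^ γ)) +
          C₂ * (W x + W x ^ γ)) + D * (W x + W x ^ γ) := by
        gcongr
        · exact (hC₁ x).trans (by gcongr; exacts [le_self_add, hinterp x])
        · exact hC₂ x
        · exact le_self_add
    _ = ((L * b ^ q + D : ℝ≥0) : ℝ≥0∞) * (W x + W x ^ γ) := by
        rw [hL]; push_cast; ring
    _ ≤ _ := by gcongr

/-- Monotone convergence for the right-hand side of an equation of the system. -/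
theorem kernelPotential_withDensity_iSup_rpow {q : ℝ} (hq : 0 < q) {μ : Measure X}
    {f : ℕ → X → ℝ≥0∞} (hf : ∀ k, Measurable (f k)) (hmono : Monotone f) (x : X) :
    kernelPotential a (σ.withDensity (fun y => (⨆ k, f k y) ^ q) + μ) x =
      ⨆ k, kernelPotential a (σ.withDensity (fun y => f k y ^ q) + μ) x := by
  have hkm : Measurable (rieszKernel a x) := measurable_rieszKernel_right x
  have hpow : ∀ y, (⨆ k, f k y) ^ q = ⨆ k, f k y ^ q := fun y =>
    (ENNReal.orderIsoRpow q hq).map_iSup _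
  simp_rw [kernelPotential_add_measure]
  rw [← ENNReal.iSup_add, kernelPotential_withDensity _ (by fun_prop)]
  simp_rw [kernelPotential_withDensity _ ((hf _).pow_const q), hpow, ENNReal.iSup_mul]
  rw [lintegral_iSup (f := fun k y => f k y ^ q * rieszKernel a x y)
    (fun k => ((hf k).pow_const q).mul hkm)]
  intro k l hkl y
  dsimp only
  gcongr
  exact hmono hkl y

/-- A measurable subsolution of the system lying below a supersolution can be improved to a
solution between the two, by monotone iteration. -/
theorem exists_solution_between [SFinite σ] {μ₁ μ₂ : Measure X} [SFinite μ₁] [SFinite μ₂]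
    {q₁ q₂ : ℝ} (hq₁ : 0 < q₁) (hq₂ : 0 < q₂) {u₀ v₀ u₁ v₁ : X → ℝ≥0∞}
    (hu₀m : Measurable u₀) (hv₀m : Measurable v₀) (hu : ∀ x, u₀ x ≤ u₁ x) (hv : ∀ x, v₀ x ≤ v₁ x)
    (hu₀ : ∀ x, u₀ x ≤ kernelPotential a (σ.withDensity (fun y => v₀ y ^ q₁) + μ₁) x)
    (hv₀ : ∀ x, v₀ x ≤ kernelPotential a (σ.withDensity (fun y => u₀ y ^ q₂) + μ₂) x)
    (hu₁ : ∀ x, kernelPotential a (σ.withDensity (fun y => v₁ y ^ q₁) + μ₁) x ≤ u₁ x)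
    (hv₁ : ∀ x, kernelPotential a (σ.withDensity (fun y => u₁ y ^ q₂) + μ₂) x ≤ v₁ x) :
    ∃ u v : X → ℝ≥0∞, Measurable u ∧ Measurable v ∧
      (∀ x, u x = kernelPotential a (σ.withDensity (fun y => v y ^ q₁) + μ₁) x) ∧
      (∀ x, v x = kernelPotential a (σ.withDensity (fun y => u y ^ q₂) + μ₂) x) ∧
      (∀ x, u₀ x ≤ u x ∧ u x ≤ u₁ x) ∧ ∀ x, v₀ x ≤ v x ∧ v x ≤ v₁ x := by
  set T : (X → ℝ≥0∞) × (X → ℝ≥0∞) → (X → ℝ≥0∞) × (X → ℝ≥0∞) := fun w =>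
    (kernelPotential a (σ.withDensity (fun y => w.2 y ^ q₁) + μ₁),
      kernelPotential a (σ.withDensity (fun y => w.1 y ^ q₂) + μ₂)) with hT
  have hTmono : Monotone T := fun w w' h =>
    ⟨fun x => kernelPotential_withDensity_rpow_mono hq₁.le h.2 x,
      fun x => kernelPotential_withDensity_rpow_mono hq₂.le h.1 x⟩
  set w : ℕ → (X → ℝ≥0∞) × (X → ℝ≥0∞) := fun k => T^[k] (u₀, v₀) with hw
  have hstep : ∀ k, w (k + 1) = T (w k) := fun k => Function.iterate_succ_apply' T k _
  have hmono : Monotone w := hTmono.monotone_iterate_of_le_map ⟨hu₀, hv₀⟩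
  have hup : ∀ k, w k ≤ (u₁, v₁) := by
    intro k
    induction k with
    | zero => exact ⟨hu, hv⟩
    | succ k ih =>
      rw [hstep]
      exact (hTmono ih).trans ⟨hu₁, hv₁⟩
  have hmeas : ∀ k, Measurable (w k).1 ∧ Measurable (w k).2 := by
    intro k
    cases k with
    | zero => exact ⟨hu₀m, hv₀m⟩
    | succ k =>
      rw [hstep]
      exact ⟨measurable_kernelPotential _, measurable_kernelPotential _⟩
  have hm1 : Monotone fun k => (w k).1 := fun k l h => (hmono h).1
  have hm2 : Monotone fun k => (w k).2 := fun k l h => (hmono h).2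
  have hshift1 : ∀ x, ⨆ k, (w k).1 x = ⨆ k, (w (k + 1)).1 x := fun x =>
    (Monotone.iSup_nat_add (f := fun k => (w k).1 x) (fun k l h => hm1 h x) 1).symm
  have hshift2 : ∀ x, ⨆ k, (w k).2 x = ⨆ k, (w (k + 1)).2 x := fun x =>
    (Monotone.iSup_nat_add (f := fun k => (w k).2 x) (fun k l h => hm2 h x) 1).symm
  refine ⟨fun x => ⨆ k, (w k).1 x, fun x => ⨆ k, (w k).2 x, Measurable.iSup fun k => (hmeas k).1,
    Measurable.iSup fun k => (hmeas k).2, fun x => ?_, fun x => ?_, fun x => ⟨?_, ?_⟩,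
    fun x => ⟨?_, ?_⟩⟩
  · rw [kernelPotential_withDensity_iSup_rpow hq₁ (fun k => (hmeas k).2) hm2]
    refine (hshift1 x).trans ?_
    simp_rw [hstep]
    rfl
  · rw [kernelPotential_withDensity_iSup_rpow hq₂ (fun k => (hmeas k).1) hm1]
    refine (hshift2 x).trans ?_
    simp_rw [hstep]
    rfl
  · exact le_iSup (fun k => (w k).1 x) 0
  · exact iSup_le fun k => (hup k).1 x
  · exact le_iSup (fun k => (w k).2 x) 0
  · exact iSup_le fun k => (hup k).2 x

end System

end

/-! ### Solutions of the system on `ℝⁿ` -/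

theorem theorem2 (n : ℕ) (α q₁ q₂ γ₁ γ₂ : ℝ) (hα : 0 < α) (hαn : α < (n : ℝ) / 2)
    (hq₁ : 0 < q₁) (hq₁' : q₁ < 1) (hq₂ : 0 < q₂) (hq₂' : q₂ < 1)
    (hγ₁ : γ₁ = (1 + q₁) / (1 - q₁ * q₂)) (hγ₂ : γ₂ = (1 + q₂) / (1 - q₁ * q₂))
    (σ μ₁ μ₂ : Measure (EuclideanSpace ℝ (Fin n)))
    [IsLocallyFiniteMeasure σ] [IsLocallyFiniteMeasure μ₁] [IsLocallyFiniteMeasure μ₂]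
    (hσ : ∃ x, rieszPotential (2 * α) σ x < ∞)
    (hcap : ∃ C : ℝ≥0, ∀ E : Set (EuclideanSpace ℝ (Fin n)), IsCompact E →
      σ E ≤ C * rieszCapacity α E)
    (hμ₁ : ∃ C : ℝ≥0, ∀ x, rieszPotential (2 * α) μ₁ x ≤ C * rieszPotential (2 * α) σ x)
    (hμ₂ : ∃ C : ℝ≥0, ∀ x, rieszPotential (2 * α) μ₂ x ≤ C * rieszPotential (2 * α) σ x) :
    ∃ u v : EuclideanSpace ℝ (Fin n) → ℝ≥0∞,
      IsSolution α q₁ q₂ σ μ₁ μ₂ u v ∧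
      ∃ c : ℝ≥0, 0 < c ∧ ∀ x,
        ((c : ℝ≥0∞)⁻¹ * rieszPotential (2 * α) σ x ^ γ₁ ≤ u x ∧
          u x ≤ c * (rieszPotential (2 * α) σ x + rieszPotential (2 * α) σ x ^ γ₁)) ∧
        ((c : ℝ≥0∞)⁻¹ * rieszPotential (2 * α) σ x ^ γ₂ ≤ v x ∧
          v x ≤ c * (rieszPotential (2 * α) σ x + rieszPotential (2 * α) σ x ^ γ₂)) := by
  have hqq : 0 < 1 - q₁ * q₂ := by nlinarith
  have hqq0 := hqq.ne'
  have hγ₁' : γ₂ * q₁ + 1 = γ₁ := by rw [hγ₁, hγ₂, div_mul_eq_mul_div, div_add_one hqq0]; ring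
  have hγ₂' : γ₁ * q₂ + 1 = γ₂ := by rw [hγ₁, hγ₂, div_mul_eq_mul_div, div_add_one hqq0]; ring
  have h1γ₁ : 1 ≤ γ₁ := by rw [hγ₁, le_div_iff₀ hqq]; nlinarith
  have h1γ₂ : 1 ≤ γ₂ := by rw [hγ₂, le_div_iff₀ hqq]; nlinarith
  obtain ⟨K, hK⟩ := exists_lintegral_rieszPotential_restrict_le hα hαn hcap
  obtain ⟨D₁, hD₁⟩ := hμ₁
  obtain ⟨D₂, hD₂⟩ := hμ₂
  simp only [rieszPotential_eq_kernelPotential] at hσ hD₁ hD₂ ⊢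
  have ha : 0 < (n : ℝ) - 2 * α := by linarith
  have han : (n : ℝ) - 2 * α < n := by linarith
  set W := kernelPotential ((n : ℝ) - 2 * α) σ with hW
  have hWm : Measurable W := measurable_kernelPotential _
  obtain ⟨b, hb1, hl₁, hl₂, hr₁, hr₂⟩ := ((eventually_ge_atTop 1).and
    ((eventually_le_kernelPotential (σ := σ) ha hq₁ hq₁' (by linarith) hγ₁' μ₁).and
    ((eventually_le_kernelPotential (σ := σ) ha hq₂ hq₂' (by linarith) hγ₂' μ₂).and
    ((eventually_kernelPotential_le (σ := σ) ha hK hq₁ hq₁' h1γ₂ hγ₁' hD₁).and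
    (eventually_kernelPotential_le (σ := σ) ha hK hq₂ hq₂' h1γ₁ hγ₂' hD₂))))).exists
  have hb0 : 0 < b := one_pos.trans_le hb1
  have hle : ∀ (γ : ℝ) x, (b : ℝ≥0∞)⁻¹ * W x ^ γ ≤ b * (W x + W x ^ γ) := fun γ x => by
    have h1 : (1 : ℝ≥0∞) ≤ b := by exact_mod_cast hb1
    gcongr
    · exact (ENNReal.inv_le_one.2 h1).trans h1
    · exact le_add_self
  obtain ⟨u, v, hum, hvm, hu, hv, hub, hvb⟩ := exists_solution_between hq₁ hq₂
    (by fun_prop : Measurable fun x => (b : ℝ≥0∞)⁻¹ * W x ^ γ₁)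
    (by fun_prop : Measurable fun x => (b : ℝ≥0∞)⁻¹ * W x ^ γ₂)
    (hle γ₁) (hle γ₂) hl₁ hl₂ hr₁ hr₂
  obtain ⟨x₀, hx₀⟩ := hσ
  have hfin : ∀ (γ : ℝ), 1 ≤ γ → b * (W x₀ + W x₀ ^ γ) < ∞ := fun γ hγ => by
    have := ENNReal.rpow_ne_top_of_nonneg (zero_le_one.trans hγ) hx₀.ne
    finiteness
  have hu₀ : ∃ x, kernelPotential ((n : ℝ) - 2 * α)
      (σ.withDensity (fun y => v y ^ q₁) + μ₁) x < ∞ :=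
    ⟨x₀, hu x₀ ▸ (hub x₀).2.trans_lt (hfin γ₁ h1γ₁)⟩
  have hv₀ : ∃ x, kernelPotential ((n : ℝ) - 2 * α)
      (σ.withDensity (fun y => u y ^ q₂) + μ₂) x < ∞ :=
    ⟨x₀, hv x₀ ▸ (hvb x₀).2.trans_lt (hfin γ₂ h1γ₂)⟩
  refine ⟨u, v, ⟨hum, hvm, ?_, ?_, hu, hv, ?_, ?_⟩, b, hb0, fun x => ⟨hub x, hvb x⟩⟩
  · rw [funext hu]; exact ae_kernelPotential_lt_top ha han _ hu₀
  · rw [funext hv]; exact ae_kernelPotential_lt_top ha han _ hv₀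
  · rw [funext hu]; exact liminf_kernelPotential_cocompact ha han _ hu₀
  · rw [funext hv]; exact liminf_kernelPotential_cocompact ha han _ hv₀
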